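/- Let $p$ be a prime, let $K/\mathbb{Q}_p$ be a finite extension with absolute Galois group $G_K=\operatorname{Gal}(\overline{K}/K)$, and let $\overline{\mathbb{F}}_p(1)$ be the one-dimensional $\overline{\mathbb{F}}_p$-vector space $\overline{\mathbb{F}}_p$ on which $G_K$ acts through the mod $p$ cyclotomic character. Let $\pi$ be a uniformiser of $K$, let $(\pi^{1/p^n})_{n\ge 0}$ be a compatible system of $p$-power roots of $\pi$ in $\overline{K}$ (so $\pi^{1/p^0}=\pi$ and $(\pi^{1/p^{n+1}})^p=\pi^{1/p^n}$), put $K_\infty=K(\pi^{1/p^\infty})=\bigcup_n K(\pi^{1/p^n})$, and let $G_{K_\infty}=\operatorname{Gal}(\overline{K}/K_\infty)\subset G_K$. A continuous representation $V$ of $G_K$ on a finite-dimensional $\overline{\mathbb{F}}_p$-vector space (with $\overline{\mathbb{F}}_p$ discrete) is called cyclotomic-free if it admits a composition series $0=V_n\subset\dots\subset V_1\subset V_0=V$ by subrepresentations such that, for every $0\le i<n$, the representation $(V_i/V_{i+1})\otimes_{\overline{\mathbb{F}}_p}\overline{\mathbb{F}}_p(1)$ is not a Jordan–Hölder factor of $V_{i+1}$.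 Theorem. Let $V$ and $W$ be cyclotomic-free continuous representations of $G_K$ on finite-dimensional $\overline{\mathbb{F}}_p$-vector spaces, and let $f\colon V\to W$ be a $G_{K_\infty}$-equivariant $\overline{\mathbb{F}}_p$-linear map. Then $f$ is $G_K$-equivariant. -/

import Mathlib

noncomputable section

namespace CycFree

section Rep

variable {k G V : Type*} [Field k] [Group G] [AddCommGroup V] [Module k V]

/-- For subrepresentations `A ≤ B` of `ρ`, the quotient representation `B / A`
(in general this is `B / (A ∩ B)`; it is only used for `A ≤ B`). -/
def subquotient {ρ : Representation k G V} (A B : Subrepresentation ρ) :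
    Representation k G (B.toSubmodule ⧸ A.toSubmodule.submoduleOf B.toSubmodule) :=
  B.toRepresentation.quotient (A.toSubmodule.submoduleOf B.toSubmodule)
    (fun g _ hv => A.apply_mem_toSubmodule g hv)

/-- A composition series `0 = V_n ⊂ ⋯ ⊂ V_1 ⊂ V_0 = V` of a representation: a decreasing chain of
subrepresentations, all of whose successive quotients `V_i / V_{i+1}` are irreducible. -/
structure CompSeries (ρ : Representation k G V) where
  /-- the number `n` of steps -/
  length : ℕ
  /-- the subrepresentations `V_i` -/
  sub : Fin (length + 1) → Subrepresentation ρ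
  sub_zero : sub 0 = ⊤
  sub_last : sub (Fin.last length) = ⊥
  le : ∀ i : Fin length, sub i.succ ≤ sub i.castSucc
  irreducible : ∀ i : Fin length, (subquotient (sub i.succ) (sub i.castSucc)).IsIrreducible

/-- The representation `V_i / V_{i+1}`. -/
abbrev CompSeries.factor {ρ : Representation k G V} (s : CompSeries ρ) (i : Fin s.length) :=
  subquotient (s.sub i.succ) (s.sub i.castSucc)

/-- `σ` is a Jordan-Hölder factor of `ρ`: it is isomorphic to a successive quotient of a
composition series of `ρ`. -/
def IsJHFactor {U : Type*} [AddCommGroup U] [Module k U]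
    (σ : Representation k G U) (ρ : Representation k G V) : Prop :=
  ∃ (s : CompSeries ρ) (i : Fin s.length), Nonempty (σ.Equiv (s.factor i))

end Rep

section Galois

variable (p : ℕ) [Fact p.Prime] (K : Type*) [Field K] [Algebra ℚ_[p] K]

/-- `G_K`, the absolute Galois group of `K`, with its Krull topology. -/
abbrev GK (K : Type*) [Field K] := Gal(AlgebraicClosure K/K)

/-- `\overline{𝔽}_p`. -/
abbrev Fbar (p : ℕ) [Fact p.Prime] := AlgebraicClosure (ZMod p)

theorem card_rootsOfUnity_algebraicClosure :
    Nat.card (rootsOfUnity p (AlgebraicClosure K)) = p := by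
  have : CharZero (AlgebraicClosure K) := charZero_of_injective_algebraMap
    ((algebraMap K (AlgebraicClosure K)).comp (algebraMap ℚ_[p] K)).injective
  exact HasEnoughRootsOfUnity.natCard_rootsOfUnity _ p

/-- The mod `p` cyclotomic character of `G_K`: `g ζ = ζ ^ χ(g)` for all `ζ` with `ζ ^ p = 1`. -/
def cyc : GK K →* (ZMod p)ˣ :=
  (modularCyclotomicCharacter (AlgebraicClosure K)
    (card_rootsOfUnity_algebraicClosure p K)).comp
    (MulSemiringAction.toRingAut (GK K) (AlgebraicClosure K))

/-- `\overline{𝔽}_p(1)`: the line `\overline{𝔽}_p` on which `G_K` acts through the mod `p`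
cyclotomic character. -/
def Fbar1 : Representation (Fbar p) (GK K) (Fbar p) :=
  (Algebra.lmul (Fbar p) (Fbar p) : Fbar p →* Module.End (Fbar p) (Fbar p)).comp
    ((algebraMap (ZMod p) (Fbar p) : ZMod p →* Fbar p).comp ((Units.coeHom (ZMod p)).comp (cyc p K)))

/-- A representation of `G_K` over `\overline{𝔽}_p` is cyclotomic-free if it has a composition
series `(V_i)` such that, for every `i`, the representation `V_i / V_{i+1} ⊗ \overline{𝔽}_p(1)` is
not a Jordan-Hölder factor of `V_{i+1}`. -/
def IsCyclotomicFree {V : Type*} [AddCommGroup V] [Module (Fbar p) V]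
    (ρ : Representation (Fbar p) (GK K) V) : Prop :=
  ∃ s : CompSeries ρ, ∀ i : Fin s.length,
    ¬ IsJHFactor ((s.factor i).tprod (Fbar1 p K)) (s.sub i.succ).toRepresentation

/-- `K_∞ = K(π^{1/p^∞})`, for a system `ϖ n = π^{1/p^n}` of elements of the algebraic closure. -/
def Kinf {K : Type*} [Field K] (ϖ : ℕ → AlgebraicClosure K) :
    IntermediateField K (AlgebraicClosure K) :=
  IntermediateField.adjoin K (Set.range ϖ)

/-- `G_{K_∞}`, as a subgroup of `G_K`. -/
def GKinf {K : Type*} [Field K] (ϖ : ℕ → AlgebraicClosure K) : Subgroup (GK K) :=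
  (Kinf ϖ).fixingSubgroup

end Galois

end CycFree

end

noncomputable section

namespace CycFree

open scoped NNReal

/-! ### Covering pairs of subrepresentations and irreducible subquotients. -/

section Lattice

variable {k G V : Type*} [Field k] [Group G] [AddCommGroup V] [Module k V]
  {ρ : Representation k G V}

/-! Commuting with `f` is an open condition on `G_K`, so by compactness `f` already commutes with
the stabiliser of `π^{1/p^m}` for some `m`. Fix a finite normal `L/K` containing `π^{1/p^m}` and a
primitive `p`-th root of unity, such that both representations are trivial on `Gal(K̄/L)`, and let
`P ⊂ G_K` consist of the elements restricting to wild inertia in `Gal(L/K)`.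

Two facts about `P` drive the proof. Its image in `Gal(L/K)` is a normal `p`-group, so it acts
trivially on every irreducible subquotient in characteristic `p` (`trivialOnFactors_wildSubgroup`).
Moreover each step of the tower is wildly ramified: some `x ∈ P` fixes `π^{1/p^n}` and moves
`π^{1/p^{n+1}}` (`exists_wildSubgroup_apply_ne`). By Kummer theory the powers of `x` represent the
cosets of the next stabiliser, and conjugation by `g` raises `x` to the power `χ(g)` modulo that
stabiliser, `χ` being the cyclotomic character (`isKummerChain_stab`).

Let `c` be a cocycle with coefficients on which `P` is trivial, and suppose `c` vanishes at the
bottom of the tower. Climbing one step, `c x` is a `χ`-eigenvector; if there is none, `c = 0`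
(`IsKummerChain.cocycle_eq_zero`). In `Hom(A, B)` with `A`, `B` irreducible, a nonzero eigenvector
is an isomorphism of `A(1)` with `B`, which is what cyclotomic-freeness excludes.
`IsKummerChain.cocycle_mem` extends this to reducible targets.

This is applied twice along a composition series: to splittings `X/Y → U`, showing that subspaces of
`W` stable under the finite-level stabiliser are `G_K`-stable (`IsKummerChain.stable_of_stable`),
and then, images under `f` being thereby subrepresentations, to `g ↦ g f g⁻¹ - f`
(`IsKummerChain.equivariant`). -/

theorem subrepresentation_toSubmodule_strictMono :
    StrictMono (Subrepresentation.toSubmodule : Subrepresentation ρ → Submodule k V) :=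
  fun _ _ h => h

instance [FiniteDimensional k V] : WellFoundedLT (Subrepresentation ρ) :=
  subrepresentation_toSubmodule_strictMono.wellFoundedLT

instance [FiniteDimensional k V] : WellFoundedGT (Subrepresentation ρ) :=
  subrepresentation_toSubmodule_strictMono.wellFoundedGT

/-- The preimage in `ρ` of a subrepresentation of a subquotient. -/
def liftSub {Y X : Subrepresentation ρ} (Z : Subrepresentation (subquotient Y X)) :
    Subrepresentation ρ where
  toSubmodule := (Z.toSubmodule.comap (Submodule.mkQ _)).map X.toSubmodule.subtype
  apply_mem_toSubmodule g v := by
    rintro ⟨w, hw, rfl⟩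
    exact ⟨X.toRepresentation g w, Z.apply_mem_toSubmodule g hw, rfl⟩

theorem mem_liftSub {Y X : Subrepresentation ρ} (Z : Subrepresentation (subquotient Y X)) (v : V) :
    v ∈ (liftSub Z).toSubmodule ↔
      ∃ h : v ∈ X.toSubmodule, Submodule.Quotient.mk ⟨v, h⟩ ∈ Z.toSubmodule := by
  constructor
  · rintro ⟨w, hw, rfl⟩
    exact ⟨w.2, hw⟩
  · rintro ⟨h, hv⟩
    exact ⟨⟨v, h⟩, hv, rfl⟩

/-- The image in a subquotient of a subrepresentation of `ρ`. -/
def projSub (Y X Z : Subrepresentation ρ) : Subrepresentation (subquotient Y X) where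
  toSubmodule := (Z.toSubmodule.submoduleOf X.toSubmodule).map (Submodule.mkQ _)
  apply_mem_toSubmodule g v := by
    rintro ⟨w, hw, rfl⟩
    exact ⟨X.toRepresentation g w, Z.apply_mem_toSubmodule g hw, rfl⟩

theorem isIrreducible_subquotient {Y X : Subrepresentation ρ} (h : Y ⋖ X) :
    (subquotient Y X).IsIrreducible := by
  have hle : Y.toSubmodule ≤ X.toSubmodule := h.le
  obtain ⟨x, hx, hxY⟩ := SetLike.exists_of_lt (show Y.toSubmodule < X.toSubmodule from h.lt)
  have hne : (⊥ : Subrepresentation (subquotient Y X)) ≠ ⊤ := by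
    intro he
    have h1 : (Submodule.Quotient.mk ⟨x, hx⟩ : X.toSubmodule ⧸ Y.toSubmodule.submoduleOf _) ∈
        (⊤ : Subrepresentation (subquotient Y X)).toSubmodule := Submodule.mem_top
    rw [← he] at h1
    exact hxY ((Submodule.Quotient.mk_eq_zero (Y.toSubmodule.submoduleOf X.toSubmodule)).1 h1)
  refine { exists_pair_ne := ⟨⊥, ⊤, hne⟩, eq_bot_or_eq_top := fun Z => ?_ }
  have h1 : Y ≤ liftSub Z := fun v hv => (mem_liftSub Z v).2 ⟨hle hv, by
    rw [(Submodule.Quotient.mk_eq_zero _).2]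
    · exact Z.toSubmodule.zero_mem
    · exact hv⟩
  have h2 : liftSub Z ≤ X := fun v hv => ((mem_liftSub Z v).1 hv).1
  rcases h.eq_or_eq h1 h2 with h3 | h3
  · left
    apply Subrepresentation.toSubmodule_injective
    refine (Submodule.eq_bot_iff _).2 fun z hz => ?_
    obtain ⟨w, rfl⟩ := Submodule.Quotient.mk_surjective _ z
    have : (w : V) ∈ (liftSub Z).toSubmodule := (mem_liftSub Z w).2 ⟨w.2, hz⟩
    rw [h3] at this
    exact (Submodule.Quotient.mk_eq_zero _).2 this
  · right
    apply Subrepresentation.toSubmodule_injective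
    refine (Submodule.eq_top_iff').2 fun z => ?_
    obtain ⟨w, rfl⟩ := Submodule.Quotient.mk_surjective _ z
    have hw : (w : V) ∈ (liftSub Z).toSubmodule := by rw [h3]; exact w.2
    exact ((mem_liftSub Z w).1 hw).2

theorem covBy_of_isIrreducible_subquotient {Y X : Subrepresentation ρ} (hle : Y ≤ X)
    (h : (subquotient Y X).IsIrreducible) : Y ⋖ X := by
  have hle' : Y.toSubmodule ≤ X.toSubmodule := hle
  refine ⟨lt_of_le_of_ne hle ?_, fun Z hYZ hZX => ?_⟩
  · rintro rfl
    apply (bot_ne_top (α := Subrepresentation (subquotient Y Y)))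
    apply Subrepresentation.toSubmodule_injective
    symm
    refine (Submodule.eq_bot_iff _).2 fun z _ => ?_
    obtain ⟨w, rfl⟩ := Submodule.Quotient.mk_surjective _ z
    exact (Submodule.Quotient.mk_eq_zero _).2 w.2
  · obtain ⟨x, hx, hxZ⟩ := SetLike.exists_of_lt (show Z.toSubmodule < X.toSubmodule from hZX)
    obtain ⟨z, hz, hzY⟩ := SetLike.exists_of_lt (show Y.toSubmodule < Z.toSubmodule from hYZ)
    rcases eq_bot_or_eq_top (projSub Y X Z) with h1 | h1
    · apply hzY
      have : (Submodule.Quotient.mk ⟨z, hZX.le hz⟩ : X.toSubmodule ⧸ Y.toSubmodule.submoduleOf _) ∈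
        (projSub Y X Z).toSubmodule := ⟨⟨z, hZX.le hz⟩, hz, rfl⟩
      rw [h1] at this
      exact (Submodule.Quotient.mk_eq_zero (Y.toSubmodule.submoduleOf X.toSubmodule)).1 this
    · have : (Submodule.Quotient.mk ⟨x, hx⟩ : X.toSubmodule ⧸ Y.toSubmodule.submoduleOf _) ∈
        (projSub Y X Z).toSubmodule := by rw [h1]; exact Submodule.mem_top
      obtain ⟨w, hw, hwx⟩ := this
      have h2 : (w : V) - x ∈ Y.toSubmodule := 
        (Submodule.Quotient.eq (Y.toSubmodule.submoduleOf X.toSubmodule)).1 hwx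
      apply hxZ
      have := Z.toSubmodule.sub_mem hw (hYZ.le h2)
      simpa using this

theorem CompSeries.covBy (s : CompSeries ρ) (i : Fin s.length) :
    s.sub i.succ ⋖ s.sub i.castSucc :=
  covBy_of_isIrreducible_subquotient (s.le i) (s.irreducible i)

end Lattice

/-! ### Maximal chains in orders with both chain conditions. -/

section Chains

variable {α : Type*} [PartialOrder α] [BoundedOrder α] [WellFoundedLT α] [WellFoundedGT α]

theorem exists_covBy_chain_to_bot (a : α) :
    ∃ (n : ℕ) (f : ℕ → α), f 0 = a ∧ f n = ⊥ ∧ ∀ i < n, f (i + 1) ⋖ f i := by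
  induction a using WellFoundedLT.induction with
  | ind a ih =>
    rcases eq_bot_or_bot_lt a with rfl | ha
    · exact ⟨0, fun _ => ⊥, rfl, rfl, by simp⟩
    · obtain ⟨b, -, hb⟩ := exists_le_covBy_of_lt ha
      obtain ⟨n, f, h0, hn, hf⟩ := ih b hb.lt
      refine ⟨n + 1, fun i => Nat.casesOn i a f, rfl, hn, fun i hi => ?_⟩
      cases i with
      | zero => simpa [h0] using hb
      | succ i => exact hf i (by omega)

theorem exists_covBy_chain_from_top (a : α) :
    ∃ (n : ℕ) (f : ℕ → α), f 0 = ⊤ ∧ f n = a ∧ ∀ i < n, f (i + 1) ⋖ f i := by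
  induction a using WellFoundedGT.induction with
  | ind a ih =>
    rcases eq_top_or_lt_top a with rfl | ha
    · exact ⟨0, fun _ => ⊤, rfl, rfl, by simp⟩
    · obtain ⟨b, hb, -⟩ := exists_covBy_le_of_lt ha
      obtain ⟨n, f, h0, hn, hf⟩ := ih b hb.lt
      refine ⟨n + 1, fun i => if i ≤ n then f i else a, by simpa using h0, by simp, fun i hi => ?_⟩
      rcases Nat.lt_succ_iff_lt_or_eq.1 hi with h | rfl
      · simpa [h.le, Nat.succ_le_of_lt h] using hf i h
      · simpa [hn] using hb

theorem exists_covBy_chain_through {a b : α} (h : b ⋖ a) :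
    ∃ (n : ℕ) (f : ℕ → α) (j : ℕ), j < n ∧ f j = a ∧ f (j + 1) = b ∧ f 0 = ⊤ ∧ f n = ⊥ ∧
      ∀ i < n, f (i + 1) ⋖ f i := by
  obtain ⟨n, f, h0, hn, hf⟩ := exists_covBy_chain_from_top a
  obtain ⟨m, e, k0, km, ke⟩ := exists_covBy_chain_to_bot b
  refine ⟨n + 1 + m, fun i => if i ≤ n then f i else e (i - (n + 1)), n, by omega, by simp [hn],
    by simp [k0], by simp [h0], ?_, fun i hi => ?_⟩
  · have : ¬ (n + 1 + m ≤ n) := by omega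
    simpa [this] using km
  · rcases lt_trichotomy i n with h1 | rfl | h1
    · simpa [h1.le, Nat.succ_le_of_lt h1] using hf i h1
    · simpa [hn, k0] using h
    · have h2 : ¬ (i ≤ n) := by omega
      have h3 : ¬ (i + 1 ≤ n) := by omega
      have h4 : i + 1 - (n + 1) = i - (n + 1) + 1 := by omega
      simp only [h2, h3, if_false, h4]
      exact ke _ (by omega)

end Chains

/-! ### Jordan–Hölder factors from covering pairs. -/

section Factors

variable {k G V : Type*} [Field k] [Group G] [AddCommGroup V] [Module k V]
  {ρ : Representation k G V} [FiniteDimensional k V]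

/-- Finite dimension gives both chain conditions, so any covering pair lies on a maximal chain,
which is a composition series. -/
theorem isJHFactor_of_covBy {U : Type*} [AddCommGroup U] [Module k U] {σ : Representation k G U}
    {Y X : Subrepresentation ρ} (h : Y ⋖ X) (e : σ.Equiv (subquotient Y X)) : IsJHFactor σ ρ := by
  obtain ⟨n, f, j, hj, rfl, rfl, h0, hn, hf⟩ := exists_covBy_chain_through h
  exact ⟨{ length := n, sub := fun i => f i, sub_zero := h0, sub_last := hn,
           le := fun i => (hf i i.2).le
           irreducible := fun i => isIrreducible_subquotient (hf i i.2) }, ⟨j, hj⟩, ⟨e⟩⟩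

end Factors

/-! ### Kummer chains and the vanishing of cocycles. -/

section Cocycles

variable {k G : Type*} [Field k] [Group G]

/-- A chain of subgroups `H 0 ≥ H 1 ≥ ⋯ ≥ H m` starting at the whole group, in which every step is
generated by an element of `P` on which conjugation acts through the character `χ`. -/
structure IsKummerChain (χ : G →* k) (P : Subgroup G) (H : ℕ → Subgroup G) (m : ℕ) : Prop where
  zero : H 0 = ⊤
  char_eq_one : ∀ x ∈ P, χ x = 1
  step : ∀ n < m, ∃ x ∈ P ⊓ H n, (∀ g ∈ H n, ∃ j : ℕ, (x ^ j)⁻¹ * g ∈ H (n + 1)) ∧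
    ∀ g ∈ H n, ∃ j : ℕ, (j : k) = χ g ∧ (x ^ j)⁻¹ * (g * x * g⁻¹) ∈ H (n + 1)

variable {χ : G →* k} {P : Subgroup G} {H : ℕ → Subgroup G} {m : ℕ}

/-- The generators of all steps lie in `P`, whence `G = P · H n`. Anything stable under `P` and the
bottom group is therefore stable under `G`. -/
theorem IsKummerChain.exists_mul_mem (hH : IsKummerChain χ P H m) {n : ℕ} (hn : n ≤ m) (g : G) :
    ∃ x ∈ P, x⁻¹ * g ∈ H n := by
  induction n with
  | zero => exact ⟨1, P.one_mem, by simp [hH.zero]⟩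
  | succ n ih =>
    obtain ⟨x, hx, hxg⟩ := ih (by omega)
    obtain ⟨y, hy, hy1, -⟩ := hH.step n (by omega)
    obtain ⟨j, hj⟩ := hy1 _ hxg
    refine ⟨x * y ^ j, P.mul_mem hx (P.pow_mem hy.1 j), ?_⟩
    rwa [mul_inv_rev, mul_assoc]

variable {M : Type*} [AddCommGroup M] [Module k M] {ρ : Representation k G M} {c : G → M}

theorem cocycle_one (hc : ∀ g h, c (g * h) = c g + ρ g (c h)) : c 1 = 0 := by
  simpa using hc 1 1

/-- A cocycle vanishing at the bottom of a Kummer chain vanishes, if `P` acts trivially on the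
coefficients and the coefficients contain no vector on which the group acts through `χ`. -/
theorem IsKummerChain.cocycle_eq_zero (hH : IsKummerChain χ P H m)
    (hc : ∀ g h, c (g * h) = c g + ρ g (c h)) (hP : ∀ x ∈ P, ρ x = 1)
    (hχ : ∀ v : M, (∀ g, ρ g v = χ g • v) → v = 0) (hm : ∀ g ∈ H m, c g = 0) (g : G) :
    c g = 0 := by
  -- Climb from the bottom: `n` counts the steps above `H m`.
  suffices h : ∀ n ≤ m, ∀ g ∈ H (m - n), c g = 0 from h m le_rfl g (by simp [hH.zero])
  intro n
  induction n with
  | zero => simpa using hm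
  | succ n ih =>
    intro hn g hg
    have hs : m - n = m - (n + 1) + 1 := by omega
    obtain ⟨x, hx, hx1, hx2⟩ := hH.step (m - (n + 1)) (by omega)
    rw [← hs] at hx1 hx2
    replace ih := ih (by omega)
    have hpow : ∀ j : ℕ, c (x ^ j) = (j : k) • c x := by
      intro j
      induction j with
      | zero => simpa using cocycle_one hc
      | succ j ihj => rw [pow_succ', hc, ihj, hP x hx.1]; push_cast; simp [add_smul, add_comm]
    have hfac : ∀ (j : ℕ) (y : G), (x ^ j)⁻¹ * y ∈ H (m - n) → c y = (j : k) • c x := by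
      intro j y hy
      have := hc (x ^ j) ((x ^ j)⁻¹ * y)
      rwa [ih _ hy, map_zero, add_zero, mul_inv_cancel_left, hpow] at this
    have hconj : ∀ y, c (y * x * y⁻¹) = ρ y (c x) := by
      intro y
      have h0 : c y + ρ y (c y⁻¹) = 0 := by rw [← hc, mul_inv_cancel, cocycle_one hc]
      rw [mul_assoc, hc, hc, hP x hx.1, Module.End.one_apply, map_add]
      rw [add_left_comm, h0, add_zero]
    have hx0 : c x = 0 := by
      refine hχ _ fun y => ?_
      -- The conjugation rule is known only on `H (m - (n + 1))`. The remaining factor `z ∈ P` acts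
      -- trivially and has `χ z = 1`, so `c x` is an eigenvector for all of `G`.
      obtain ⟨z, hz, hzy⟩ := hH.exists_mul_mem (n := m - (n + 1)) (by omega) y
      obtain ⟨j, hj, hj'⟩ := hx2 _ hzy
      have h1 := hfac j _ hj'
      rw [hconj, hj] at h1
      have h2 : y = z * (z⁻¹ * y) := by group
      rw [h2, map_mul ρ z, map_mul χ z, hP z hz, hH.char_eq_one z hz, one_mul, one_mul, h1]
    obtain ⟨j, hj⟩ := hx1 g hg
    rw [hfac j g hj, hx0, smul_zero]

end Cocycles

/-! ### Cocycles with values in `Hom(A, W)`, by dévissage. -/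

section Descent

variable {k G A W : Type*} [Field k] [Group G] [AddCommGroup A] [Module k A]
  [AddCommGroup W] [Module k W]

/-- `P` acts trivially on all irreducible subquotients of `ρ`. -/
def TrivialOnFactors (P : Subgroup G) (ρ : Representation k G W) : Prop :=
  ∀ Y X : Subrepresentation ρ, Y ⋖ X → ∀ x ∈ P, ∀ v ∈ X.toSubmodule, ρ x v - v ∈ Y.toSubmodule

theorem TrivialOnFactors.subquotient_eq_one {P : Subgroup G} {ρ : Representation k G W}
    (hP : TrivialOnFactors P ρ) {Y X : Subrepresentation ρ} (h : Y ⋖ X) {x : G} (hx : x ∈ P) :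
    subquotient Y X x = 1 := by
  ext v
  exact (Submodule.Quotient.eq (Y.toSubmodule.submoduleOf X.toSubmodule)).2
    (hP Y X h x hx v v.2)

/-- The twist of `α` by the character `χ` is a quotient of a subrepresentation of `T`. -/
def TwistOccurs (χ : G →* k) (α : Representation k G A) {ρ : Representation k G W}
    (T : Subrepresentation ρ) : Prop :=
  ∃ X ≤ T, ∃ φ : X.toSubmodule →ₗ[k] A, Function.Surjective φ ∧
    ∀ g v, φ (X.toRepresentation g v) = χ g • α g (φ v)

variable {χ : G →* k} {P : Subgroup G} {H : ℕ → Subgroup G} {m : ℕ}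
  {α : Representation k G A} {ρ : Representation k G W}

/-- A nonzero eigenvector in `Hom(A, X / Y)` exhibits the twist of `A` as a subquotient. -/
theorem twistOccurs_of_eigenvector (hα : α.IsIrreducible) {Y X T : Subrepresentation ρ}
    (h : Y ⋖ X) (hXT : X ≤ T)
    {v : A →ₗ[k] (X.toSubmodule ⧸ Y.toSubmodule.submoduleOf X.toSubmodule)}
    (hv : ∀ g, (α.linHom (subquotient Y X)) g v = χ g • v) (hv0 : v ≠ 0) : TwistOccurs χ α T := by
  have hirr := isIrreducible_subquotient h
  have hχ : ∀ g, χ g ≠ 0 := fun g h0 => by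
    have := map_mul χ g g⁻¹
    simp [h0] at this
  have hcomm : ∀ g a, subquotient Y X g (v a) = χ g • v (α g a) := fun g a => by
    have := congrArg (fun w => w (α g a)) (hv g)
    simpa using this
  have hinj : Function.Injective v := by
    let N : Subrepresentation α := ⟨LinearMap.ker v, fun g a ha => by
      have h1 := hcomm g a
      rw [LinearMap.mem_ker.1 ha, map_zero] at h1
      exact (smul_eq_zero_iff_right (hχ g)).1 h1.symm⟩
    rcases eq_bot_or_eq_top N with h1 | h1
    · exact LinearMap.ker_eq_bot.1 (congrArg Subrepresentation.toSubmodule h1)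
    · exact (hv0 (LinearMap.ker_eq_top.1 (congrArg Subrepresentation.toSubmodule h1))).elim
  have hsurj : Function.Surjective v := by
    let N : Subrepresentation (subquotient Y X) := ⟨LinearMap.range v, by
      rintro g _ ⟨a, rfl⟩
      exact ⟨χ g • α g a, by rw [hcomm, map_smul]⟩⟩
    rcases eq_bot_or_eq_top N with h1 | h1
    · exact (hv0 (LinearMap.range_eq_bot.1 (congrArg Subrepresentation.toSubmodule h1))).elim
    · exact LinearMap.range_eq_top.1 (congrArg Subrepresentation.toSubmodule h1)
  let e := LinearEquiv.ofBijective v ⟨hinj, hsurj⟩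
  refine ⟨X, hXT, e.symm.toLinearMap ∘ₗ Submodule.mkQ _,
    e.symm.surjective.comp (Submodule.mkQ_surjective _), fun g w => ?_⟩
  obtain ⟨a, ha⟩ := hsurj (Submodule.mkQ _ w)
  have h1 : (Submodule.mkQ (Y.toSubmodule.submoduleOf X.toSubmodule)) (X.toRepresentation g w) =
      v (χ g • α g a) := by
    rw [map_smul, ← hcomm, ha]; rfl
  simp only [LinearMap.comp_apply, LinearEquiv.coe_coe]
  rw [h1, ← ha]
  change e.symm (e _) = _ • α g (e.symm (e _))
  simp

/-- Take the smallest `X` between `U` and `T` containing all values. If `X ≠ U`, choose `Y ⋖ X`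
above `U`: the cocycle modulo `Y` vanishes at the bottom and its coefficients `Hom(A, X / Y)` have
no `χ`-eigenvector, so it is zero, contradicting minimality. -/
theorem IsKummerChain.cocycle_mem [FiniteDimensional k W] (hH : IsKummerChain χ P H m)
    (hα : α.IsIrreducible) (hPα : ∀ x ∈ P, α x = 1) (hPρ : TrivialOnFactors P ρ)
    {U T : Subrepresentation ρ} (hUT : U ≤ T) (hT : ¬ TwistOccurs χ α T) {c : G → A →ₗ[k] W}
    (hc : ∀ g h, c (g * h) = c g + (α.linHom ρ) g (c h)) (hcT : ∀ g a, c g a ∈ T.toSubmodule)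
    (hcU : ∀ g ∈ H m, ∀ a, c g a ∈ U.toSubmodule) (g : G) (a : A) : c g a ∈ U.toSubmodule := by
  obtain ⟨X, ⟨hUX, hXT, hcX⟩, hmin⟩ := WellFounded.has_min
    (wellFounded_lt (α := Subrepresentation ρ))
    {X | U ≤ X ∧ X ≤ T ∧ ∀ g a, c g a ∈ X.toSubmodule} ⟨T, hUT, le_rfl, hcT⟩
  rcases hUX.eq_or_lt with rfl | hlt
  · exact hcX g a
  exfalso
  obtain ⟨Y, hUY, hYX⟩ := exists_le_covBy_of_lt hlt
  refine hmin Y ⟨hUY, hYX.le.trans hXT, ?_⟩ hYX.lt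
  let c' : G → A →ₗ[k] (X.toSubmodule ⧸ Y.toSubmodule.submoduleOf X.toSubmodule) :=
    fun g => Submodule.mkQ _ ∘ₗ (c g).codRestrict X.toSubmodule (hcX g)
  have hc'0 : ∀ g a, c' g a = 0 ↔ c g a ∈ Y.toSubmodule := fun g a =>
    Submodule.Quotient.mk_eq_zero (Y.toSubmodule.submoduleOf X.toSubmodule)
  have hc' : ∀ g h, c' (g * h) = c' g + (α.linHom (subquotient Y X)) g (c' h) := by
    intro g h
    ext a
    refine congrArg (Submodule.mkQ (Y.toSubmodule.submoduleOf X.toSubmodule))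
      (a₁ := (c (g * h)).codRestrict X.toSubmodule (hcX _) a)
      (a₂ := (c g).codRestrict X.toSubmodule (hcX _) a +
        X.toRepresentation g ((c h).codRestrict X.toSubmodule (hcX _) (α g⁻¹ a))) ?_
    ext
    simp only [hc]
    rfl
  intro g a
  rw [← hc'0]
  have := hH.cocycle_eq_zero hc' (fun x hx => ?_) (fun v hv => ?_) (fun h hh => ?_) g
  · rw [this]; rfl
  · ext v b
    simp [hPα _ (P.inv_mem hx), hPρ.subquotient_eq_one hYX hx]
  · by_contra hv0
    exact hT (twistOccurs_of_eigenvector hα hYX hXT hv hv0)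
  · ext b
    exact (hc'0 h b).2 (hUY (hcU h hh b))

end Descent

/-! ### Subspaces stable at the bottom of the chain are subrepresentations. -/

section Stability

variable {k G W : Type*} [Field k] [Group G] [AddCommGroup W] [Module k W]
  {χ : G →* k} {P : Subgroup G} {H : ℕ → Subgroup G} {m : ℕ} {ρ : Representation k G W}

/-- A series such that no twist of a factor `V_i / V_{i+1}` occurs in `V_{i+1}`. -/
def CompSeries.IsTwistFree (χ : G →* k) (s : CompSeries ρ) : Prop :=
  ∀ i, ¬ TwistOccurs χ (s.factor i) (s.sub i.succ)

/-- Stability under `P` and under the bottom of a Kummer chain implies stability. -/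
theorem IsKummerChain.apply_mem (hH : IsKummerChain χ P H m) {U : Submodule k W}
    (hU : ∀ h ∈ H m, ∀ u ∈ U, ρ h u ∈ U) (hP : ∀ x ∈ P, ∀ u ∈ U, ρ x u ∈ U) (g : G) {u : W}
    (hu : u ∈ U) : ρ g u ∈ U := by
  obtain ⟨x, hx, hxg⟩ := hH.exists_mul_mem le_rfl g
  have : g = x * (x⁻¹ * g) := by group
  rw [this, map_mul]
  exact hP x hx _ (hU _ hxg _ hu)

/-- Induction up the series, for `U` inside `X`. Either `U ≤ Y`, or `U` surjects onto `X / Y`; in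
the latter case a linear section `σ` with values in `U` gives the cocycle `g σ g⁻¹ - σ` valued in
`Y`, which must take values in `U ⊓ Y`. -/
theorem IsKummerChain.stable_of_stable [FiniteDimensional k W] (hH : IsKummerChain χ P H m)
    (hPρ : TrivialOnFactors P ρ) {s : CompSeries ρ} (hs : s.IsTwistFree χ) {U : Submodule k W}
    (hU : ∀ h ∈ H m, ∀ u ∈ U, ρ h u ∈ U) (g : G) {u : W} (hu : u ∈ U) : ρ g u ∈ U := by
  suffices h : ∀ i, ∀ U : Submodule k W, U ≤ (s.sub i).toSubmodule →
      (∀ h ∈ H m, ∀ u ∈ U, ρ h u ∈ U) → ∀ g, ∀ u ∈ U, ρ g u ∈ U from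
    h 0 U (by rw [s.sub_zero]; exact le_top) hU g u hu
  clear hU hu u g U
  intro i
  induction i using Fin.reverseInduction with
  | last =>
    intro U hUs _ g u hu
    have := hUs hu
    rw [s.sub_last] at this
    have h0 : u = 0 := this
    rw [h0, map_zero]
    exact U.zero_mem
  | cast i ih =>
    intro U hUs hU
    set X := s.sub i.castSucc with hX
    set Y := s.sub i.succ with hY
    have hYX : Y ⋖ X := s.covBy i
    have hle : Y.toSubmodule ≤ X.toSubmodule := hYX.le
    have hstab := ih (U ⊓ Y.toSubmodule) inf_le_right fun h hh u hu =>
      ⟨hU h hh u hu.1, Y.apply_mem_toSubmodule h hu.2⟩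
    let U' : Subrepresentation ρ := ⟨U ⊓ Y.toSubmodule, hstab⟩
    -- `U + Y` is stable under `P`, which is trivial on `X / Y`, and under `H m`, hence under `G`;
    -- irreducibility of `X / Y` leaves only `Y` and `X`.
    let Z : Subrepresentation ρ := ⟨U ⊔ Y.toSubmodule, fun g v hv => by
      refine hH.apply_mem ?_ ?_ g hv
      · intro h hh u hu
        obtain ⟨a, ha, b, hb, rfl⟩ := Submodule.mem_sup.1 hu
        rw [map_add]
        exact Submodule.add_mem_sup (hU h hh a ha) (Y.apply_mem_toSubmodule h hb)
      · intro x hx u hu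
        have h1 := hPρ Y X hYX x hx u ((sup_le hUs hle : U ⊔ Y.toSubmodule ≤ X.toSubmodule) hu)
        have h2 : ρ x u = (ρ x u - u) + u := by abel
        rw [h2]
        exact Submodule.add_mem _ (Submodule.mem_sup_right h1) hu⟩
    have hYZ : Y ≤ Z := fun y hy => Submodule.mem_sup_right hy
    have hZX : Z ≤ X := (sup_le hUs hle : U ⊔ Y.toSubmodule ≤ X.toSubmodule)
    rcases hYX.eq_or_eq hYZ hZX with hZ | hZ
    · have hUY : U ≤ Y.toSubmodule := by
        have h1 : U ⊔ Y.toSubmodule = Y.toSubmodule := congrArg Subrepresentation.toSubmodule hZ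
        exact sup_eq_right.1 h1
      intro g u hu
      exact (hstab g u ⟨hu, hUY hu⟩).1
    have hZ' : U ⊔ Y.toSubmodule = X.toSubmodule := congrArg Subrepresentation.toSubmodule hZ
    -- a linear section of `X → X / Y` with values in `U`
    let q : U →ₗ[k] (X.toSubmodule ⧸ Y.toSubmodule.submoduleOf X.toSubmodule) :=
      Submodule.mkQ _ ∘ₗ Submodule.inclusion hUs
    have hq : Function.Surjective q := by
      intro z
      obtain ⟨w, rfl⟩ := Submodule.Quotient.mk_surjective _ z
      have hw : (w : W) ∈ U ⊔ Y.toSubmodule := by rw [hZ']; exact w.2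
      obtain ⟨a, ha, b, hb, hab⟩ := Submodule.mem_sup.1 hw
      refine ⟨⟨a, ha⟩, (Submodule.Quotient.eq (Y.toSubmodule.submoduleOf X.toSubmodule)).2 ?_⟩
      change a - (w : W) ∈ Y.toSubmodule
      rw [← hab]
      simpa using hb
    obtain ⟨t, ht⟩ := q.exists_rightInverse_of_surjective (LinearMap.range_eq_top.2 hq)
    have ht' : ∀ z, q (t z) = z := fun z => LinearMap.congr_fun ht z
    let σ : (X.toSubmodule ⧸ Y.toSubmodule.submoduleOf X.toSubmodule) →ₗ[k] W := U.subtype ∘ₗ t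
    have hσU : ∀ z, σ z ∈ U := fun z => (t z).2
    have hσ : ∀ z w (hw : w ∈ X.toSubmodule), z = Submodule.Quotient.mk ⟨w, hw⟩ →
        σ z - w ∈ Y.toSubmodule := by
      intro z w hw hz
      have h1 := ht' z
      rw [hz] at h1
      rw [hz]
      exact (Submodule.Quotient.eq (Y.toSubmodule.submoduleOf X.toSubmodule)).1 h1
    have hσ' : ∀ z (h : σ z ∈ X.toSubmodule), (Submodule.Quotient.mk ⟨σ z, h⟩ :
        X.toSubmodule ⧸ Y.toSubmodule.submoduleOf X.toSubmodule) = z := fun z h => ht' z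
    let α := s.factor i
    let c : G → (X.toSubmodule ⧸ Y.toSubmodule.submoduleOf X.toSubmodule) →ₗ[k] W :=
      fun g => (α.linHom ρ) g σ - σ
    have hcY : ∀ g a, c g a ∈ Y.toSubmodule := by
      intro g a
      have hmem : ∀ b, σ b ∈ X.toSubmodule := fun b => hUs (hσU b)
      have h1 := hσ a (ρ g (σ (α g⁻¹ a))) (X.apply_mem_toSubmodule g (hmem _)) (by
        have h2 : a = α g (α g⁻¹ a) := by simp
        conv_lhs => rw [h2, ← hσ' (α g⁻¹ a) (hmem _)]
        rfl)
      have h3 := Y.toSubmodule.neg_mem h1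
      rw [neg_sub] at h3
      exact h3
    have hcU : ∀ g a, c g a ∈ U'.toSubmodule := by
      refine hH.cocycle_mem (T := Y) (s.irreducible i)
        (fun x hx => hPρ.subquotient_eq_one hYX hx) hPρ (inf_le_right (a := U)) (hs i) ?_ hcY ?_
      · intro g h
        simp only [c, map_mul, map_sub, Module.End.mul_apply]
        abel
      · intro h hh a
        exact ⟨U.sub_mem (hU h hh _ (hσU _)) (hσU _), hcY h a⟩
    intro g u hu
    have huX := hUs hu
    -- Split `u` as `σ z` minus an element of `U ⊓ Y`; each part stays in `U` under `g`.
    let z : X.toSubmodule ⧸ Y.toSubmodule.submoduleOf X.toSubmodule :=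
      Submodule.Quotient.mk ⟨u, huX⟩
    have h1 : σ z - u ∈ U ⊓ Y.toSubmodule := ⟨U.sub_mem (hσU z) hu, hσ z u huX rfl⟩
    have h2 : ρ g (σ z) ∈ U := by
      have h3 := (hcU g (α g z)).1
      have h4 : c g (α g z) = ρ g (σ z) - σ (α g z) := by simp [c]
      rw [h4] at h3
      simpa using U.add_mem h3 (hσU (α g z))
    have h5 := U.sub_mem h2 (hstab g _ h1).1
    simpa using h5

end Stability

/-! ### The abstract form of the theorem. -/

section Equivariance

variable {k G V W : Type*} [Field k] [Group G] [AddCommGroup V] [Module k V]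
  [AddCommGroup W] [Module k W] [FiniteDimensional k W]
  {χ : G →* k} {P : Subgroup G} {H : ℕ → Subgroup G} {m : ℕ}
  {ρ : Representation k G V} {τ : Representation k G W}

/-- Induction up the series of the source. With `f` equivariant on `Y`, the defect `g f g⁻¹ - f` is
a cocycle on `X / Y` with values in `f(Y)`, a quotient of `Y`, where the twist of `X / Y` cannot
occur. -/
theorem IsKummerChain.equivariant (hH : IsKummerChain χ P H m) (hPρ : TrivialOnFactors P ρ)
    (hPτ : TrivialOnFactors P τ) {s : CompSeries ρ} (hs : s.IsTwistFree χ)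
    {t : CompSeries τ} (ht : t.IsTwistFree χ) {f : V →ₗ[k] W}
    (hf : ∀ h ∈ H m, ∀ v, f (ρ h v) = τ h (f v)) (g : G) (v : V) : f (ρ g v) = τ g (f v) := by
  have himg : ∀ X : Subrepresentation ρ, ∀ g, ∀ w ∈ X.toSubmodule.map f,
      τ g w ∈ X.toSubmodule.map f := fun X g w hw =>
    hH.stable_of_stable hPτ ht (by
      rintro h hh _ ⟨x, hx, rfl⟩
      exact ⟨ρ h x, X.apply_mem_toSubmodule h hx, hf h hh x⟩) g hw
  suffices h : ∀ i, ∀ v ∈ (s.sub i).toSubmodule, ∀ g, f (ρ g v) = τ g (f v) from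
    h 0 v (by rw [s.sub_zero]; exact Submodule.mem_top) g
  clear v g
  intro i
  induction i using Fin.reverseInduction with
  | last =>
    intro v hv g
    rw [s.sub_last] at hv
    have h0 : v = 0 := hv
    simp [h0]
  | cast i ih =>
    set X := s.sub i.castSucc with hX
    set Y := s.sub i.succ with hY
    have hYX : Y ⋖ X := s.covBy i
    have hle : Y.toSubmodule ≤ X.toSubmodule := hYX.le
    let fX : Subrepresentation τ := ⟨X.toSubmodule.map f, himg X⟩
    let fY : Subrepresentation τ := ⟨Y.toSubmodule.map f, himg Y⟩
    have hfYX : fY ≤ fX := Submodule.map_mono (f := f) hYX.le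
    -- `P` acts trivially on `f(X) / f(Y)`
    have hPf : ∀ x ∈ P, ∀ v ∈ X.toSubmodule, τ x (f v) - f v ∈ fY.toSubmodule := by
      rcases hfYX.eq_or_lt with h1 | h1
      · intro x hx v hv
        have h2 : f v ∈ fX.toSubmodule := ⟨v, hv, rfl⟩
        rw [h1]
        exact fX.toSubmodule.sub_mem (fX.apply_mem_toSubmodule x h2) h2
      -- An intermediate `Z` pulls back to a subspace of `X` containing `Y`, stable under `P` and `H
      -- m` and hence under `G`; so `f(X) / f(Y)` is irreducible and `P` is trivial on it.
      · have hcov : fY ⋖ fX := by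
          refine ⟨h1, fun Z hYZ hZX => ?_⟩
          let Z' : Subrepresentation ρ := ⟨X.toSubmodule ⊓ Z.toSubmodule.comap f, fun g v hv => by
            refine hH.apply_mem (fun h hh u hu => ?_) (fun x hx u hu => ?_) g hv
            · refine ⟨X.apply_mem_toSubmodule h hu.1, ?_⟩
              change f (ρ h u) ∈ Z.toSubmodule
              rw [hf h hh]
              exact Z.apply_mem_toSubmodule h hu.2
            · have h2 := hPρ Y X hYX x hx u hu.1
              refine ⟨X.apply_mem_toSubmodule x hu.1, ?_⟩
              have h3 : f (ρ x u - u) ∈ Z.toSubmodule := hYZ.le ⟨_, h2, rfl⟩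
              rw [map_sub] at h3
              have h4 := Z.toSubmodule.add_mem h3 hu.2
              simpa using h4⟩
          have hYZ' : Y ≤ Z' := fun y hy => ⟨hle hy, hYZ.le ⟨y, hy, rfl⟩⟩
          have hZX' : Z' ≤ X := fun z hz => hz.1
          rcases hYX.eq_or_eq hYZ' hZX' with h2 | h2
          · refine hYZ.not_ge fun w hw => ?_
            obtain ⟨v, hv, rfl⟩ := hZX.le hw
            have h3 : v ∈ Z'.toSubmodule := ⟨hv, hw⟩
            rw [h2] at h3
            exact ⟨v, h3, rfl⟩
          · refine hZX.not_ge fun w hw => ?_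
            obtain ⟨v, hv, rfl⟩ := hw
            have h3 : v ∈ Z'.toSubmodule := by rw [h2]; exact hv
            exact h3.2
        intro x hx v hv
        exact hPτ fY fX hcov x hx _ ⟨v, hv, rfl⟩
    -- the cocycle `g ↦ g f g⁻¹ - f` on `X / Y`
    have hdiff : ∀ g, ∀ v ∈ X.toSubmodule, τ g (f (ρ g⁻¹ v)) - f v ∈ fY.toSubmodule := by
      intro g v hv
      obtain ⟨x, hx, hxg⟩ := hH.exists_mul_mem le_rfl g
      -- The factor of `g` in `H m` commutes with `f`, so only its factor in `P` contributes.
      have h1 : τ g (f (ρ g⁻¹ v)) = τ x (f (ρ x⁻¹ v)) := by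
        obtain ⟨y, hy, rfl⟩ : ∃ y ∈ H m, g = x * y := ⟨x⁻¹ * g, hxg, by group⟩
        rw [mul_inv_rev, map_mul, map_mul, Module.End.mul_apply, Module.End.mul_apply,
          hf _ ((H m).inv_mem hy)]
        simp
      have h2 : ρ x⁻¹ v - v ∈ Y.toSubmodule := hPρ Y X hYX _ (P.inv_mem hx) v hv
      have h3 : f (ρ x⁻¹ v) - f v ∈ fY.toSubmodule := ⟨_, h2, map_sub _ _ _⟩
      have h4 := fY.toSubmodule.add_mem (fY.apply_mem_toSubmodule x h3) (hPf x hx v hv)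
      rw [h1]
      simpa using h4
    have hker : ∀ g, Y.toSubmodule.submoduleOf X.toSubmodule ≤
        LinearMap.ker (((ρ.linHom τ) g f - f) ∘ₗ X.toSubmodule.subtype) := by
      intro g y hy
      have hy' : (y : V) ∈ Y.toSubmodule := hy
      rw [LinearMap.mem_ker]
      have h1 := ih (ρ g⁻¹ y) (Y.apply_mem_toSubmodule _ hy') g
      simp only [LinearMap.comp_apply, LinearMap.sub_apply, Representation.linHom_apply,
        Submodule.subtype_apply]
      rw [← h1]
      simp
    let c : G → (X.toSubmodule ⧸ Y.toSubmodule.submoduleOf X.toSubmodule) →ₗ[k] W :=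
      fun g => Submodule.liftQ _ _ (hker g)
    have hcmk : ∀ g (v : X.toSubmodule), c g (Submodule.Quotient.mk v) =
      τ g (f (ρ g⁻¹ v)) - f v := fun g v => rfl
    have hc0 : ∀ g a, c g a ∈ (⊥ : Subrepresentation τ).toSubmodule := by
      refine hH.cocycle_mem (T := fY) (s.irreducible i)
        (fun x hx => hPρ.subquotient_eq_one hYX hx) hPτ bot_le ?_ ?_ ?_ ?_
      -- An occurrence of the twist in `f(Y)` pulls back along the equivariant map `Y → f(Y)`.
      · rintro ⟨Z, hZ, φ, hφ, hφg⟩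
        apply hs i
        have hcomm : ∀ g, ∀ v ∈ Y.toSubmodule, f (ρ g v) = τ g (f v) := fun g v hv => ih v hv g
        let Z' : Subrepresentation ρ := ⟨Y.toSubmodule ⊓ Z.toSubmodule.comap f, fun g v hv =>
          ⟨Y.apply_mem_toSubmodule g hv.1, by
            change f (ρ g v) ∈ Z.toSubmodule
            rw [hcomm g v hv.1]
            exact Z.apply_mem_toSubmodule g hv.2⟩⟩
        let r : Z'.toSubmodule →ₗ[k] Z.toSubmodule := f.restrict fun v hv => hv.2
        refine ⟨Z', inf_le_left (a := Y.toSubmodule), φ ∘ₗ r, hφ.comp ?_, fun g v => ?_⟩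
        · rintro ⟨z, hz⟩
          obtain ⟨y, hy, rfl⟩ := hZ hz
          exact ⟨⟨y, hy, hz⟩, rfl⟩
        · have h1 : r (Z'.toRepresentation g v) = Z.toRepresentation g (r v) := by
            ext
            exact hcomm g v v.2.1
          simp only [LinearMap.comp_apply]
          rw [h1, hφg]
      · intro g h
        refine LinearMap.ext fun a => ?_
        obtain ⟨v, rfl⟩ := Submodule.Quotient.mk_surjective _ a
        have h1 : c h (s.factor i g⁻¹ (Submodule.Quotient.mk v)) =
          τ h (f (ρ h⁻¹ (ρ g⁻¹ v))) - f (ρ g⁻¹ v) := rfl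
        simp only [LinearMap.add_apply, Representation.linHom_apply, LinearMap.comp_apply]
        rw [h1, hcmk, hcmk]
        simp
      · intro g a
        obtain ⟨v, rfl⟩ := Submodule.Quotient.mk_surjective _ a
        exact hdiff g v v.2
      · intro h hh a
        obtain ⟨v, rfl⟩ := Submodule.Quotient.mk_surjective _ a
        rw [hcmk, hf _ ((H m).inv_mem hh)]
        simp
    intro v hv g
    have h1 : c g (Submodule.Quotient.mk ⟨ρ g v, X.apply_mem_toSubmodule g hv⟩) = 0 := hc0 _ _
    rw [hcmk] at h1
    simpa [eq_comm] using sub_eq_zero.1 h1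

end Equivariance

/-! ### Occurrence of a twist as a Jordan–Hölder factor. -/

section Twist

variable {k G A W : Type*} [Field k] [Group G] [AddCommGroup A] [Module k A]
  [AddCommGroup W] [Module k W] [FiniteDimensional k W] {χ : G →* k}
  {α : Representation k G A} {ρ : Representation k G W}

/-- The kernel of the surjection from `X` is covered by `X`, because twisting by a character
preserves irreducibility. -/
theorem TwistOccurs.isJHFactor {β : Representation k G k} (hβ : ∀ g x, β g x = χ g * x)
    (hα : α.IsIrreducible) {T : Subrepresentation ρ} (h : TwistOccurs χ α T) :
    IsJHFactor (α.tprod β) T.toRepresentation := by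
  obtain ⟨X, hXT, φ, hφ, hφg⟩ := h
  have hχ : ∀ g, χ g ≠ 0 := fun g h0 => by
    have := map_mul χ g g⁻¹
    simp [h0] at this
  let X' : Subrepresentation T.toRepresentation :=
    ⟨X.toSubmodule.submoduleOf T.toSubmodule, fun g v hv => X.apply_mem_toSubmodule g hv⟩
  let ι : X'.toSubmodule →ₗ[k] X.toSubmodule :=
    (T.toSubmodule.subtype ∘ₗ X'.toSubmodule.subtype).codRestrict _ fun v => v.2
  have hι : Function.Surjective ι := fun x => ⟨⟨⟨x, hXT x.2⟩, x.2⟩, rfl⟩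
  let ψ := φ ∘ₗ ι
  have hψ : Function.Surjective ψ := hφ.comp hι
  have hψg : ∀ g v, ψ (X'.toRepresentation g v) = χ g • α g (ψ v) := fun g v => hφg g (ι v)
  let Y' : Subrepresentation T.toRepresentation :=
    ⟨(LinearMap.ker ψ).map X'.toSubmodule.subtype, by
      rintro g _ ⟨v, hv, rfl⟩
      refine ⟨X'.toRepresentation g v, ?_, rfl⟩
      change ψ _ = 0
      rw [hψg, show ψ v = 0 from hv, map_zero, smul_zero]⟩
  have hmemY : ∀ v : X'.toSubmodule, (v : T.toSubmodule) ∈ Y'.toSubmodule ↔ ψ v = 0 := by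
    intro v
    constructor
    · rintro ⟨w, hw, hwv⟩
      rw [← Subtype.ext hwv]
      exact hw
    · intro hv
      exact ⟨v, hv, rfl⟩
  have hYX : Y' ≤ X' := by
    rintro _ ⟨v, -, rfl⟩
    exact v.2
  have hker : Y'.toSubmodule.submoduleOf X'.toSubmodule = LinearMap.ker ψ := by
    ext v
    exact hmemY v
  have hcov : Y' ⋖ X' := by
    refine ⟨lt_of_le_of_ne hYX fun h => ?_, fun Z hYZ hZX => ?_⟩
    · have h0 : ∀ a : A, a = 0 := fun a => by
        obtain ⟨v, rfl⟩ := hψ a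
        exact (hmemY v).1 (by rw [h]; exact v.2)
      apply bot_ne_top (α := Subrepresentation α)
      apply Subrepresentation.toSubmodule_injective
      ext a
      rw [h0 a]
      exact ⟨fun _ => Submodule.mem_top, fun _ => Submodule.zero_mem _⟩
    · let N : Subrepresentation α :=
        ⟨(Z.toSubmodule.submoduleOf X'.toSubmodule).map ψ, by
          rintro g _ ⟨v, hv, rfl⟩
          refine ⟨(χ g)⁻¹ • X'.toRepresentation g v,
            Submodule.smul_mem _ _ (Z.apply_mem_toSubmodule g hv), ?_⟩
          rw [map_smul, hψg, smul_smul, inv_mul_cancel₀ (hχ g), one_smul]⟩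
      rcases eq_bot_or_eq_top N with hN | hN
      · refine hYZ.not_ge fun z hz => ?_
        have h1 : ψ ⟨z, hZX.le hz⟩ ∈ N.toSubmodule := ⟨⟨z, hZX.le hz⟩, hz, rfl⟩
        rw [hN] at h1
        exact (hmemY ⟨z, hZX.le hz⟩).2 h1
      · refine hZX.not_ge fun x hx => ?_
        have h1 : ψ ⟨x, hx⟩ ∈ N.toSubmodule := by rw [hN]; exact Submodule.mem_top
        obtain ⟨w, hw, hwx⟩ := h1
        have h2 : ψ (w - ⟨x, hx⟩) = 0 := by rw [map_sub, hwx, sub_self]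
        have h3 := Z.toSubmodule.sub_mem hw (hYZ.le ((hmemY _).2 h2))
        change x ∈ Z.toSubmodule
        simpa using h3
  let e : (X'.toSubmodule ⧸ Y'.toSubmodule.submoduleOf X'.toSubmodule) ≃ₗ[k] A :=
    (Submodule.quotEquivOfEq _ _ hker).trans (ψ.quotKerEquivOfSurjective hψ)
  have he : ∀ v : X'.toSubmodule, e (Submodule.Quotient.mk v) = ψ v := fun v => rfl
  refine isJHFactor_of_covBy hcov (Representation.Equiv.mk
    ((TensorProduct.rid k A).trans e.symm) fun g => ?_)
  refine TensorProduct.ext' fun a x => ?_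
  apply e.injective
  obtain ⟨v, rfl⟩ := hψ a
  have h1 : e.symm (ψ v) = Submodule.Quotient.mk v := by rw [← he, e.symm_apply_apply]
  have h2 : e (subquotient Y' X' g (Submodule.Quotient.mk v)) = χ g • α g (ψ v) := hψg g v
  simp [hβ, h1, h2, smul_smul, mul_comm]

end Twist

/-! ### Actions of `p`-groups in characteristic `p`. -/

section PGroups

variable {p : ℕ} [Fact p.Prime] {k G A : Type*} [Field k] [Group G]
  [AddCommGroup A] [Module k A]

/-- A group acting additively through a finite group, whose elements act by operators of
`p`-power order, on a nonzero `𝔽_p`-vector space, has a nonzero fixed vector. -/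
theorem exists_fixed_vector_of_zmod [Module (ZMod p) A] {α : Representation k G A}
    (hfin : (Set.range α).Finite) (hp : ∀ g, ∃ n : ℕ, α (g ^ p ^ n) = 1) {a : A} (ha : a ≠ 0) :
    ∃ b ≠ 0, ∀ g, α g b = b := by
  have hpA : ∀ b : A, p • b = 0 := fun b => by
    rw [← Nat.cast_smul_eq_nsmul (ZMod p), CharP.cast_eq_zero, zero_smul]
  -- The `𝔽_p`-span of the finite orbit is finite even when `k` is not, so fixed points can be
  -- counted modulo `p`: `0` is fixed, hence so is another vector.
  let S : Submodule (ZMod p) A := Submodule.span (ZMod p) (Set.range fun g => α g a)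
  have hSfin : (Set.range fun g => α g a).Finite := by
    have : (Set.range fun g => α g a) = (fun f : Module.End k A => f a) '' Set.range α := by
      rw [← Set.range_comp]; rfl
    rw [this]
    exact hfin.image _
  have : Module.Finite (ZMod p) ↥S := Module.Finite.span_of_finite (ZMod p) hSfin
  have : Finite ↥S := Module.finite_of_finite (ZMod p)
  have hS : ∀ g, ∀ b ∈ S, α g b ∈ S := by
    intro g b hb
    induction hb using Submodule.span_induction with
    | mem x hx =>
      obtain ⟨h, rfl⟩ := hx
      exact Submodule.subset_span ⟨g * h, by simp⟩
    | zero => simp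
    | add x y _ _ hx hy => rw [map_add]; exact S.add_mem hx hy
    | smul c x _ hx =>
      rw [ZMod.map_smul (α g)]
      exact S.smul_mem c hx
  let _ : MulAction G S :=
    { smul := fun g b => ⟨α g b, hS g b b.2⟩
      one_smul := fun b => Subtype.ext (by change α 1 (b : A) = b; simp)
      mul_smul := fun g h b => Subtype.ext (by change α (g * h) (b : A) = α g (α h b); simp) }
  have hsmul : ∀ (g : G) (b : S), ((g • b : S) : A) = α g b := fun _ _ => rfl
  have hQ : IsPGroup p (MulAction.toPermHom G S).range := by
    rintro ⟨_, g, rfl⟩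
    obtain ⟨n, hn⟩ := hp g
    refine ⟨n, Subtype.ext ?_⟩
    ext b
    have h1 := hsmul (g ^ p ^ n) b
    rw [hn] at h1
    rw [Subgroup.coe_pow, ← map_pow]
    exact h1
  have hcard : p ∣ Nat.card S := by
    have h1 : addOrderOf (⟨a, Submodule.subset_span ⟨1, by simp⟩⟩ : S) = p :=
      addOrderOf_eq_prime (Subtype.ext (hpA a)) fun h => ha (congrArg Subtype.val h)
    exact (dvd_of_eq h1.symm).trans (addOrderOf_dvd_natCard _)
  obtain ⟨b, hb, hb0⟩ := hQ.exists_fixed_point_of_prime_dvd_card_of_fixed_point S hcard (a := 0) (by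
    rintro ⟨_, g, rfl⟩
    exact Subtype.ext (map_zero (α g)))
  refine ⟨b, fun h => hb0 (Subtype.ext h.symm), fun g => ?_⟩
  exact congrArg Subtype.val (hb ⟨MulAction.toPermHom G S g, g, rfl⟩)

/-- A group acting through a finite group, whose elements act by operators of `p`-power order,
on a nonzero vector space of characteristic `p`, has a nonzero fixed vector. -/
theorem exists_fixed_vector [CharP k p] {α : Representation k G A} (hfin : (Set.range α).Finite)
    (hp : ∀ g, ∃ n : ℕ, α (g ^ p ^ n) = 1) {a : A} (ha : a ≠ 0) :
    ∃ b ≠ 0, ∀ g, α g b = b := by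
  let _ : Module (ZMod p) A := AddCommGroup.zmodModule fun b => by
    rw [← Nat.cast_smul_eq_nsmul k, CharP.cast_eq_zero, zero_smul]
  exact exists_fixed_vector_of_zmod hfin hp ha

variable {W : Type*} [AddCommGroup W] [Module k W]

/-- A normal subgroup whose elements act with `p`-power order acts trivially on all irreducible
subquotients in characteristic `p`. -/
theorem trivialOnFactors_of_pow_eq_one [CharP k p] {ρ : Representation k G W}
    (hfin : (Set.range ρ).Finite) {P : Subgroup G} [P.Normal] (hP : ∀ x ∈ P, ∃ n : ℕ, ρ (x ^ p ^ n) = 1) :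
    TrivialOnFactors P ρ := by
  intro Y X h
  have hirr := isIrreducible_subquotient h
  obtain ⟨w, hw, hwY⟩ := SetLike.exists_of_lt (show Y.toSubmodule < X.toSubmodule from h.lt)
  let α := subquotient Y X
  have hα : ∀ g h, ρ g = ρ h → α g = α h := by
    intro g h hgh
    have h1 : X.toRepresentation g = X.toRepresentation h := by
      ext v
      exact congrArg (fun f => f (v : W)) hgh
    ext v
    exact congrArg (fun f => (Submodule.mkQ (Y.toSubmodule.submoduleOf X.toSubmodule)) (f v)) h1
  -- The `P`-fixed vectors form a subrepresentation since `P` is normal; they are nonzero, hence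
  -- everything.
  let F : Subrepresentation α :=
    ⟨⨅ x : P, LinearMap.eqLocus (α x) LinearMap.id, fun g v hv => by
      simp only [Submodule.mem_iInf, LinearMap.mem_eqLocus, LinearMap.id_apply] at hv ⊢
      intro x
      have h1 := hv ⟨g⁻¹ * x * g, by simpa using ‹P.Normal›.conj_mem x x.2 g⁻¹⟩
      have h2 : α x (α g v) = α g (α (g⁻¹ * x * g) v) := by
        simp only [← Module.End.mul_apply, ← map_mul]
        congr 2
        group
      rw [h2, h1]⟩
  have hF : ∀ v, v ∈ F.toSubmodule ↔ ∀ x ∈ P, α x v = v := by simp [F]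
  rcases eq_bot_or_eq_top F with h1 | h1
  · exfalso
    have hsub : Set.range (α.comp P.subtype) ⊆ Set.range α := by
      rintro _ ⟨x, rfl⟩
      exact ⟨x, rfl⟩
    have hfinα : (Set.range α).Finite := by
      have h2 : Set.range α = (fun f => α (Function.invFun ρ f)) '' Set.range ρ := by
        rw [← Set.range_comp]
        congr 1
        ext1 g
        exact hα _ _ (Function.invFun_eq ⟨g, rfl⟩).symm
      rw [h2]
      exact hfin.image _
    obtain ⟨b, hb, hb'⟩ := exists_fixed_vector (p := p) (α := α.comp P.subtype)
      (hfinα.subset hsub) (fun x => by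
        obtain ⟨n, hn⟩ := hP x x.2
        refine ⟨n, ?_⟩
        have := hα (x ^ p ^ n) 1 (by rw [hn, map_one])
        rw [map_one] at this
        simpa using this) (a := Submodule.Quotient.mk ⟨w, hw⟩)
      (fun h0 => hwY ((Submodule.Quotient.mk_eq_zero
        (Y.toSubmodule.submoduleOf X.toSubmodule)).1 h0))
    have h2 : b ∈ F.toSubmodule := (hF b).2 fun x hx => hb' ⟨x, hx⟩
    rw [h1] at h2
    exact hb h2
  · intro x hx v hv
    have h2 : (Submodule.Quotient.mk ⟨v, hv⟩ : X.toSubmodule ⧸ _) ∈ F.toSubmodule := by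
      rw [h1]; exact Submodule.mem_top
    exact (Submodule.Quotient.eq (Y.toSubmodule.submoduleOf X.toSubmodule)).1 ((hF _).1 h2 x hx)

end PGroups

/-! ### Inertia and wild inertia of group actions on valued fields. -/

section Valued

variable {L Γ : Type*} [Field L] [Group Γ] [MulSemiringAction Γ L] {v : Valuation L ℝ≥0}

/-- The wild inertia group: the elements acting trivially on the graded pieces of the valuation
filtration. -/
def wildInertia (v : Valuation L ℝ≥0) (hv : ∀ (g : Γ) x, v (g • x) = v x) : Subgroup Γ where
  carrier := {g | ∀ x, x ≠ 0 → v (g • x - x) < v x}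
  one_mem' x hx := by simpa [zero_lt_iff] using hx
  mul_mem' {g h} hg hh x hx := by
    have h1 : (g * h) • x - x = g • (h • x - x) + (g • x - x) := by
      rw [smul_sub, mul_smul]; abel
    rw [h1]
    refine v.map_add_lt ?_ (hg x hx)
    rw [hv]
    exact hh x hx
  inv_mem' {g} hg x hx := by
    have h1 : g⁻¹ • x - x = -(g⁻¹ • (g • x - x)) := by
      rw [smul_sub, inv_smul_smul]; abel
    rw [h1, Valuation.map_neg, hv]
    exact hg x hx

/-- The inertia group: the elements acting trivially on the residue field. -/
def inertiaSubgroup (v : Valuation L ℝ≥0) (hv : ∀ (g : Γ) x, v (g • x) = v x) : Subgroup Γ where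
  carrier := {g | ∀ x, v x ≤ 1 → v (g • x - x) < 1}
  one_mem' x _ := by simp
  mul_mem' {g h} hg hh x hx := by
    have h1 : (g * h) • x - x = g • (h • x - x) + (g • x - x) := by
      rw [smul_sub, mul_smul]; abel
    rw [h1]
    refine v.map_add_lt ?_ (hg x hx)
    rw [hv]
    exact hh x hx
  inv_mem' {g} hg x hx := by
    have h1 : g⁻¹ • x - x = -(g⁻¹ • (g • x - x)) := by
      rw [smul_sub, inv_smul_smul]; abel
    rw [h1, Valuation.map_neg, hv]
    exact hg x hx

variable {hv : ∀ (g : Γ) x, v (g • x) = v x}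

theorem wildInertia_normal : (wildInertia v hv).Normal where
  conj_mem g hg h x hx := by
    have h1 : (h * g * h⁻¹) • x - x = h • (g • (h⁻¹ • x) - h⁻¹ • x) := by
      rw [smul_sub, smul_inv_smul, mul_smul, mul_smul]
    rw [h1, hv, ← hv h⁻¹ x]
    exact hg _ ((smul_ne_zero_iff_ne h⁻¹).2 hx)

theorem smul_natCast_eq (g : Γ) (n : ℕ) : g • (n : L) = n :=
  map_natCast (MulSemiringAction.toRingHom Γ L g) n

theorem valuation_natCast_le_one (v : Valuation L ℝ≥0) (n : ℕ) : v (n : L) ≤ 1 := by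
  induction n with
  | zero => simp
  | succ n ih => push_cast; exact v.map_add_le ih (by simp)

theorem valuation_natCast_eq_one {p : ℕ} (hp : v (p : L) < 1) {r : ℕ} (hr : p.Coprime r) :
    v (r : L) = 1 := by
  refine le_antisymm (valuation_natCast_le_one v r) (not_lt.1 fun h => ?_)
  obtain ⟨a, b, hab⟩ := Nat.isCoprime_iff_coprime.2 hr
  have hint : ∀ a : ℤ, v (a : L) ≤ 1 := fun a => by
    obtain ⟨n, rfl | rfl⟩ := a.eq_nat_or_neg
    · simpa using valuation_natCast_le_one v n
    · simpa using valuation_natCast_le_one v n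
  have h1 : v ((a : L) * p + b * r) < 1 := by
    refine v.map_add_lt ?_ ?_
    · rw [map_mul]; exact mul_lt_one_of_nonneg_of_lt_one_right (hint a) zero_le hp
    · rw [map_mul]; exact mul_lt_one_of_nonneg_of_lt_one_right (hint b) zero_le h
  have h2 : (a : L) * p + b * r = 1 := by exact_mod_cast congrArg (Int.cast : ℤ → L) hab
  rw [h2, map_one] at h1
  exact lt_irrefl _ h1

variable {p : ℕ} [hpp : Fact p.Prime]

/-- Elements of the wild inertia of order prime to the residue characteristic are trivial. -/
theorem smul_eq_of_pow_eq_one {g : Γ} (hg : g ∈ wildInertia v hv) {r : ℕ} (hgr : g ^ r = 1)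
    (hr : v (r : L) = 1) (x : L) : g • x = x := by
  -- The trace over the powers of `g` is injective, since `A x` is `r * x` up to smaller valuation;
  -- it kills `r * x - A x`, so `r * x = A x` is fixed by `g`.
  let A : L → L := fun x => ∑ i ∈ Finset.range r, g ^ i • x
  have hA : ∀ x, x ≠ 0 → A x ≠ 0 := by
    intro x hx h0
    have h1 : v (A x - r * x) < v x := by
      have h2 : A x - r * x = ∑ i ∈ Finset.range r, (g ^ i • x - x) := by
        simp [A, Finset.sum_sub_distrib]
      rw [h2]
      exact v.map_sum_lt (by simpa using hx)
        fun i _ => (wildInertia v hv).pow_mem hg i x hx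
    rw [h0, zero_sub, Valuation.map_neg, map_mul, hr, one_mul] at h1
    exact lt_irrefl _ h1
  have hgA : g • A x = A x := by
    have h1 := Finset.sum_range_succ' (fun i => g ^ i • x) r
    have h2 := Finset.sum_range_succ (fun i => g ^ i • x) r
    rw [h1] at h2
    simp only [hgr, pow_zero, add_left_inj] at h2
    simp only [A, Finset.smul_sum, ← mul_smul, ← pow_succ']
    exact h2
  have hAA : A (A x) = r * A x := by
    have h1 : ∀ i : ℕ, g ^ i • A x = A x := by
      intro i
      induction i with
      | zero => simp
      | succ i ih => rw [pow_succ, mul_smul, hgA, ih]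
    change ∑ i ∈ Finset.range r, g ^ i • A x = _
    simp [h1]
  have hlin : A (r * x - A x) = r * A x - A (A x) := by
    simp only [A, smul_sub, smul_mul', smul_natCast_eq, Finset.sum_sub_distrib, Finset.mul_sum]
  have h0 : (r : L) * x - A x = 0 := by
    by_contra h
    exact hA _ h (by rw [hlin, hAA, sub_self])
  have hr0 : (r : L) ≠ 0 := fun h => by simp [h] at hr
  have h1 : g • ((r : L) * x) = r * x := by rw [sub_eq_zero.1 h0, hgA]
  rw [smul_mul', smul_natCast_eq] at h1
  exact mul_left_cancel₀ hr0 h1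

theorem isPGroup_wildInertia [Finite Γ] [FaithfulSMul Γ L] (hp : v (p : L) < 1) :
    IsPGroup p (wildInertia v hv) := by
  rintro ⟨g, hg⟩
  obtain ⟨k, r, hr, hkr⟩ := Nat.exists_eq_pow_mul_and_not_dvd
    (isOfFinOrder_of_finite g).orderOf_pos.ne' p hpp.out.ne_one
  refine ⟨k, Subtype.ext ?_⟩
  change g ^ p ^ k = 1
  apply FaithfulSMul.eq_of_smul_eq_smul (α := L)
  intro x
  rw [one_smul]
  refine smul_eq_of_pow_eq_one ((wildInertia v hv).pow_mem hg _) (r := r) ?_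
    (valuation_natCast_eq_one hp ((hpp.out.coprime_iff_not_dvd).2 hr)) x
  rw [← pow_mul, ← hkr, pow_orderOf_eq_one]

theorem charP_residueField (hp : v (p : L) < 1) :
    CharP (IsLocalRing.ResidueField v.valuationSubring) p := by
  refine (CharP.charP_iff_prime_eq_zero hpp.out).2 ?_
  rw [← map_natCast (IsLocalRing.residue v.valuationSubring), IsLocalRing.residue_eq_zero_iff,
    Valuation.mem_maximalIdeal_iff]
  simpa using hp

theorem residue_eq_residue_iff (x y : v.valuationSubring) :
    IsLocalRing.residue v.valuationSubring x = IsLocalRing.residue v.valuationSubring y ↔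
      v ((x : L) - y) < 1 := by
  rw [← sub_eq_zero, ← map_sub, IsLocalRing.residue_eq_zero_iff, Valuation.mem_maximalIdeal_iff]
  rfl

/-- The residue field has characteristic `p`, so it has no nontrivial `p`-power roots of unity. -/
theorem valuation_sub_one_lt (hp : v (p : L) < 1) {c : L} (hc : v c ≤ 1) {k : ℕ}
    (h : v (c ^ p ^ k - 1) < 1) : v (c - 1) < 1 := by
  have := charP_residueField hp
  let c' : v.valuationSubring := ⟨c, hc⟩
  have h1 := (residue_eq_residue_iff (c' ^ p ^ k) 1).2 (by simpa using h)
  have h2 := (residue_eq_residue_iff c' 1).1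
  refine h2 ?_
  rw [← sub_eq_zero]
  rw [map_one, map_pow] at *
  have h3 := sub_pow_char_pow (n := k) (p := p) (IsLocalRing.residue v.valuationSubring c') 1
  rw [h1, one_pow, sub_self] at h3
  exact pow_eq_zero_iff (pow_ne_zero _ hpp.out.ne_zero) |>.1 h3

/-- In a `p`-group acting on a field of residue characteristic `p`, inertia is wild. -/
theorem inertiaSubgroup_le_wildInertia_of_isPGroup (hΓ : IsPGroup p Γ) (hp : v (p : L) < 1) :
    inertiaSubgroup v hv ≤ wildInertia v hv := by
  intro g hg x hx
  have hvx : v x ≠ 0 := by simpa using hx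
  have hu : ∀ h : Γ, v (h • x / x) = 1 := fun h => by rw [map_div₀, hv, div_self hvx]
  -- Inertia fixes residues, so `g ↦ g • x / x` is multiplicative modulo the maximal ideal; its
  -- residue then has `p`-power order and equals `1`.
  have hpow : ∀ n : ℕ, v (g ^ n • x / x - (g • x / x) ^ n) < 1 := by
    intro n
    induction n with
    | zero => simp [hx]
    | succ n ih =>
      have h1 : g ^ (n + 1) • x / x - (g • x / x) ^ (n + 1) =
          (g • (g ^ n • x / x) - g ^ n • x / x) * (g • x / x) +
            (g ^ n • x / x - (g • x / x) ^ n) * (g • x / x) := by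
        rw [smul_div₀', ← mul_smul, ← pow_succ']
        have h2 : g ^ (n + 1) • x / x = g ^ (n + 1) • x / g • x * (g • x / x) := by
          rw [div_mul_div_cancel₀ ((smul_ne_zero_iff_ne g).2 hx)]
        rw [h2]
        ring
      rw [h1]
      refine v.map_add_lt ?_ ?_
      · rw [map_mul, hu, mul_one]
        exact hg _ (hu _).le
      · rwa [map_mul, hu, mul_one]
  obtain ⟨k, hk⟩ := hΓ g
  have h1 := hpow (p ^ k)
  rw [hk, one_smul, div_self hx, Valuation.map_sub_swap] at h1
  have h2 := valuation_sub_one_lt hp (hu g).le h1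
  have h3 : g • x - x = (g • x / x - 1) * x := by field_simp
  rw [h3, map_mul]
  exact mul_lt_of_lt_one_left (zero_lt_iff.2 hvx) h2

theorem smul_eq_out_smul {J : Subgroup Γ} {z : L} (hz : ∀ j ∈ J, j • z = z) (g : Γ) :
    (QuotientGroup.mk g : Γ ⧸ J).out • z = g • z := by
  obtain ⟨j, hj⟩ := QuotientGroup.mk_out_eq_mul J g
  rw [hj, mul_smul, hz j j.2]

/-- If the inertia of a finite `p`-group fixes `α`, then the fixed field contains an element of the
same valuation as `α`. -/
theorem exists_fixed_valuation_eq [Finite Γ] (hΓ : IsPGroup p Γ) (hp : v (p : L) < 1) {α : L}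
    (hα0 : α ≠ 0) (hα : ∀ g : Γ, v (g • α - α) < v α) (hJ : ∀ g ∈ inertiaSubgroup v hv, g • α = α) :
    ∃ a : L, (∀ g : Γ, g • a = a) ∧ v a = v α := by
  classical
  have hchar := charP_residueField hp
  set R := v.valuationSubring
  set κ := IsLocalRing.ResidueField R
  set J := inertiaSubgroup v hv
  let _ := Fintype.ofFinite (Γ ⧸ J)
  let _ := Fintype.ofFinite J
  let act : Γ → R →+* R := fun g =>
    ((MulSemiringAction.toRingHom Γ L g).comp R.subtype).codRestrict R fun x => by
      have h1 : v (g • (x : L)) ≤ 1 := by rw [hv]; exact x.2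
      exact h1
  have hact : ∀ g x, ((act g x : R) : L) = g • (x : L) := fun _ _ => rfl
  let ψ : Γ → R →+* κ := fun g => (IsLocalRing.residue R).comp (act g)
  have hψ : ∀ g h x, ψ g x = ψ h x ↔ v (g • (x : L) - h • (x : L)) < 1 := fun g h x =>
    residue_eq_residue_iff _ _
  obtain ⟨a, ha⟩ := (hΓ.to_subgroup J).exists_card_eq
  -- Distinct cosets of inertia give distinct characters into `κ`, still distinct after the power
  -- `Nat.card J = p ^ a` because Frobenius is injective. Dedekind independence makes their sum
  -- nonzero at some `x`.
  let Φ : Γ ⧸ J → R →* κ := fun q => (powMonoidHom (Nat.card J)).comp (ψ q.out : R →* κ)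
  have hΦ : Function.Injective Φ := by
    intro q r hqr
    have h1 : (q.out)⁻¹ * r.out ∈ J := by
      intro x hx
      have h2 : (ψ q.out ⟨x, hx⟩) ^ p ^ a = (ψ r.out ⟨x, hx⟩) ^ p ^ a := by
        have := DFunLike.congr_fun hqr (⟨x, hx⟩ : R)
        rw [← ha]
        exact this
      have h3 := (hψ _ _ _).1 (iterateFrobenius_inj κ p a h2)
      rw [← hv q.out, smul_sub, mul_smul, smul_inv_smul, Valuation.map_sub_swap]
      exact h3
    rw [← QuotientGroup.out_eq' q, ← QuotientGroup.out_eq' r]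
    exact QuotientGroup.eq.2 h1
  have hindep : LinearIndependent κ (fun q => (Φ q : R → κ)) :=
    (linearIndependent_monoidHom R κ).comp Φ hΦ
  obtain ⟨x, hx⟩ : ∃ x, ∑ q, Φ q x ≠ 0 := by
    by_contra! h
    have := Fintype.linearIndependent_iff.1 hindep (fun _ => 1) (by
      ext x
      simpa using h x) (QuotientGroup.mk 1)
    exact one_ne_zero this
  -- The norm over `J` makes `y * α` invariant under `J`, so its trace over `Γ ⧸ J` is `Γ`-fixed.
  -- Divided by `α`, this trace has residue `∑ q, Φ q x ≠ 0`, hence valuation `1`.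
  let y : L := ∏ j : J, (j : Γ) • (x : L)
  have hyJ : ∀ j ∈ J, j • y = y := by
    intro j hj
    simp only [y, Finset.smul_prod', ← mul_smul]
    exact Fintype.prod_equiv (Equiv.mulLeft (⟨j, hj⟩ : J)) _ _ fun i => rfl
  have hz : ∀ j ∈ J, j • (y * α) = y * α := fun j hj => by rw [smul_mul', hyJ j hj, hJ j hj]
  have hvα : v α ≠ 0 := by simpa using hα0
  let u : Γ → R := fun g => ⟨g • α / α, by
    change v _ ≤ 1
    rw [map_div₀, hv, div_self hvα]⟩
  have hu : ∀ g, IsLocalRing.residue R (u g) = 1 := by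
    intro g
    rw [← map_one (IsLocalRing.residue R)]
    refine (residue_eq_residue_iff _ _).2 ?_
    have h1 : ((u g : R) : L) - ((1 : R) : L) = (g • α - α) / α := by
      change g • α / α - 1 = _
      field_simp
    rw [h1, map_div₀, div_lt_one₀ (zero_lt_iff.2 hvα)]
    exact hα g
  let b : R := ∑ q : Γ ⧸ J, (∏ j : J, act (q.out * j) x) * u q.out
  have hb : IsLocalRing.residue R b = ∑ q, Φ q x := by
    rw [map_sum]
    refine Finset.sum_congr rfl fun q _ => ?_
    rw [map_mul, hu, mul_one, map_prod]
    have h1 : ∀ j : J, IsLocalRing.residue R (act (q.out * j) x) = ψ q.out x := by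
      intro j
      refine (hψ (q.out * j) q.out x).2 ?_
      rw [mul_smul, ← smul_sub, hv]
      exact j.2 _ x.2
    simp [h1, Φ]
  have hvb : v (b : L) = 1 := by
    refine le_antisymm b.2 (not_lt.1 fun h => hx ?_)
    rw [← hb, IsLocalRing.residue_eq_zero_iff, Valuation.mem_maximalIdeal_iff]
    exact h
  have hbα : ∑ q : Γ ⧸ J, q.out • (y * α) = b * α := by
    have h1 : (b : L) = ∑ q : Γ ⧸ J, (∏ j : J, (q.out * j) • (x : L)) * (q.out • α / α) := by
      change R.subtype b = _
      simp only [b, map_sum, map_mul, map_prod]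
      rfl
    rw [h1, Finset.sum_mul]
    refine Finset.sum_congr rfl fun q _ => ?_
    simp only [smul_mul', y, Finset.smul_prod', ← mul_smul]
    field_simp
  refine ⟨∑ q : Γ ⧸ J, q.out • (y * α), fun g => ?_, by rw [hbα, map_mul, hvb, one_mul]⟩
  rw [Finset.smul_sum]
  refine Fintype.sum_equiv (MulAction.toPerm g) _ _ fun q => ?_
  rw [← mul_smul, ← smul_eq_out_smul hz]
  congr 2
  conv_rhs => rw [← QuotientGroup.out_eq' q]
  rfl

/-- The norm from the fixed field of `S` to the fixed field of `Γ`. -/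
theorem exists_norm [Finite Γ] {S : Subgroup Γ} (hv : ∀ (g : Γ) x, v (g • x) = v x) {a : L}
    (ha : ∀ g ∈ S, g • a = a) : ∃ b : L, (∀ g : Γ, g • b = b) ∧ v b = v a ^ S.index := by
  let _ := Fintype.ofFinite (Γ ⧸ S)
  refine ⟨∏ q : Γ ⧸ S, q.out • a, fun g => ?_, ?_⟩
  · rw [Finset.smul_prod']
    refine Fintype.prod_equiv (MulAction.toPerm g) _ _ fun q => ?_
    rw [← mul_smul, ← smul_eq_out_smul ha]
    congr 2
    conv_rhs => rw [← QuotientGroup.out_eq' q]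
    rfl
  · rw [map_prod]
    simp [hv, Subgroup.index]

/-- If the ramification forced by `α` is more than what the index of `Δ` allows, the wild inertia of
`Δ` moves `α`. -/
theorem exists_wildInertia_smul_ne [Finite Γ] (hp : v (p : L) < 1) {Δ : Subgroup Γ} {α : L}
    (hα0 : α ≠ 0) (hα : ∀ g ∈ Δ, (g • α) ^ p = α ^ p) {n : ℕ} (hΔ : ¬ p ^ n ∣ Δ.index)
    (hval : ∀ (x : L) (r : ℕ), (∀ g : Γ, g • x = x) → v x = v α ^ r → p ^ n ∣ r) :
    ∃ g ∈ wildInertia v hv ⊓ Δ, g • α ≠ α := by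
  by_contra! hfix
  have hvα : v α ≠ 0 := by simpa using hα0
  -- On a `p`-group inertia is wild, so by assumption the inertia of `S` fixes `α` and some
  -- `S`-fixed `a` has the valuation of `α`. Its norm to the fixed field of `Γ` forces `p ^ n ∣ [Γ :
  -- S] = [Δ : S] [Γ : Δ]`, where `[Δ : S]` is prime to `p`.
  obtain ⟨S⟩ : Nonempty (Sylow p Δ) := inferInstance
  have hS := S.not_dvd_index
  let S' : Subgroup Γ := (S : Subgroup Δ).map Δ.subtype
  have hS'Δ : S' ≤ Δ := Subgroup.map_subtype_le _
  have hS'p : IsPGroup p S' := S.isPGroup'.map _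
  have hvS : ∀ (g : S') x, v (g • x) = v x := fun g x => hv g x
  have hwild : ∀ g ∈ inertiaSubgroup v hvS, g • α = α := by
    intro g hg
    have h1 := inertiaSubgroup_le_wildInertia_of_isPGroup hS'p hp hg
    exact hfix g ⟨h1, hS'Δ g.2⟩
  have hlt : ∀ g : S', v (g • α - α) < v α := by
    intro g
    have h1 : v (g • α / α) = 1 := by rw [map_div₀, hvS, div_self hvα]
    have h2 : (g • α / α) ^ p ^ 1 = 1 := by
      rw [pow_one, div_pow, show (g • α) ^ p = α ^ p from hα g (hS'Δ g.2),
        div_self (pow_ne_zero _ hα0)]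
    have h3 := valuation_sub_one_lt hp h1.le (k := 1) (by rw [h2]; simp)
    have h4 : g • α - α = (g • α / α - 1) * α := by field_simp
    rw [h4, map_mul]
    exact mul_lt_of_lt_one_left (zero_lt_iff.2 hvα) h3
  obtain ⟨a, ha, hva⟩ := exists_fixed_valuation_eq hS'p hp hα0 hlt hwild
  obtain ⟨b, hb, hvb⟩ := exists_norm (S := S') hv (a := a) fun g hg => ha ⟨g, hg⟩
  rw [hva] at hvb
  have h1 := hval b _ hb hvb
  rw [Subgroup.index_map_subtype] at h1
  exact hΔ ((Nat.Coprime.pow_left n ((hpp.out.coprime_iff_not_dvd).2 hS)).dvd_of_dvd_mul_left h1)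

end Valued

/-! ### The spectral norm on algebraic extensions of `ℚ_p`. -/

section PadicValuation

variable (p : ℕ) [Fact p.Prime]

/-- The valuation on an algebraic extension of `ℚ_p` extending the `p`-adic one. -/
def padicSpectralValuation (F : Type*) [Field F] [Algebra ℚ_[p] F]
    [Algebra.IsAlgebraic ℚ_[p] F] : Valuation F ℝ≥0 where
  toFun x := ⟨spectralNorm ℚ_[p] F x, spectralNorm_nonneg x⟩
  map_zero' := Subtype.ext spectralNorm_zero
  map_one' := Subtype.ext spectralNorm_one
  map_mul' x y := Subtype.ext (spectralAlgNorm_mul (K := ℚ_[p]) x y)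
  map_add_le_max' x y := isNonarchimedean_spectralNorm (K := ℚ_[p]) x y

variable {p} {F : Type*} [Field F] [Algebra ℚ_[p] F] [Algebra.IsAlgebraic ℚ_[p] F]

theorem coe_padicSpectralValuation (x : F) :
    (padicSpectralValuation p F x : ℝ) = spectralNorm ℚ_[p] F x := rfl

theorem padicSpectralValuation_algEquiv (σ : F ≃ₐ[ℚ_[p]] F) (x : F) :
    padicSpectralValuation p F (σ x) = padicSpectralValuation p F x :=
  Subtype.ext (spectralNorm_eq_of_equiv σ x).symm

theorem padicSpectralValuation_prime_lt_one : padicSpectralValuation p F (p : F) < 1 := by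
  rw [← NNReal.coe_lt_coe, coe_padicSpectralValuation, ← map_natCast (algebraMap ℚ_[p] F),
    spectralNorm_extends]
  exact Padic.norm_p_lt_one

theorem padicSpectralValuation_algebraMap {E : Type*} [Field E] [Algebra ℚ_[p] E]
    [Algebra.IsAlgebraic ℚ_[p] E] [Algebra F E] [IsScalarTower ℚ_[p] F E] (x : F) :
    padicSpectralValuation p E (algebraMap F E x) = padicSpectralValuation p F x :=
  Subtype.ext (spectralNorm.eq_of_tower (K := ℚ_[p]) (E := F) x).symm

variable [Algebra ℤ_[p] F] [IsScalarTower ℤ_[p] ℚ_[p] F]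

theorem isIntegral_iff_padicSpectralValuation_le_one (x : F) :
    IsIntegral ℤ_[p] x ↔ padicSpectralValuation p F x ≤ 1 := by
  have hmonic : (minpoly ℚ_[p] x).Monic :=
    minpoly.monic (Algebra.IsAlgebraic.isAlgebraic x).isIntegral
  rw [← NNReal.coe_le_coe, coe_padicSpectralValuation, NNReal.coe_one, spectralNorm,
    spectralValue_le_one_iff hmonic]
  constructor
  · intro h n
    rw [minpoly.isIntegrallyClosed_eq_field_fractions' ℚ_[p] h, Polynomial.coeff_map]
    exact PadicInt.norm_le_one _
  · intro h
    have hlift : minpoly ℚ_[p] x ∈ Polynomial.lifts (algebraMap ℤ_[p] ℚ_[p]) := by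
      rw [Polynomial.lifts_iff_coeff_lifts]
      exact fun n => ⟨⟨_, h n⟩, rfl⟩
    obtain ⟨q, hq, -, hqm⟩ := Polynomial.lifts_and_degree_eq_and_monic hlift hmonic
    refine ⟨q, hqm, ?_⟩
    rw [← Polynomial.aeval_def, ← Polynomial.aeval_map_algebraMap ℚ_[p], hq, minpoly.aeval]

theorem isUnit_integralClosure_iff (x : integralClosure ℤ_[p] F) :
    IsUnit x ↔ padicSpectralValuation p F (x : F) = 1 := by
  have hle : ∀ y : integralClosure ℤ_[p] F, padicSpectralValuation p F (y : F) ≤ 1 := fun y =>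
    (isIntegral_iff_padicSpectralValuation_le_one _).1 y.2
  constructor
  · rintro ⟨u, rfl⟩
    refine le_antisymm (hle _) ?_
    have h1 : padicSpectralValuation p F ((u : integralClosure ℤ_[p] F) : F) *
        padicSpectralValuation p F ((↑u⁻¹ : integralClosure ℤ_[p] F) : F) = 1 := by
      rw [← map_mul, ← Subalgebra.coe_mul, Units.mul_inv, Subalgebra.coe_one, map_one]
    calc 1 = _ := h1.symm
      _ ≤ _ := mul_le_of_le_one_right zero_le (hle _)
  · intro h
    have hx : (x : F) ≠ 0 := fun h0 => by simp [h0] at h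
    have hinv : IsIntegral ℤ_[p] (x : F)⁻¹ := by
      rw [isIntegral_iff_padicSpectralValuation_le_one, map_inv₀, h, inv_one]
    exact IsUnit.of_mul_eq_one ⟨(x : F)⁻¹, hinv⟩ (Subtype.ext (mul_inv_cancel₀ hx))

theorem isLocalRing_integralClosure : IsLocalRing (integralClosure ℤ_[p] F) := by
  refine IsLocalRing.of_nonunits_add fun a b ha hb => ?_
  have hle : ∀ y : integralClosure ℤ_[p] F, padicSpectralValuation p F (y : F) ≤ 1 := fun y =>
    (isIntegral_iff_padicSpectralValuation_le_one _).1 y.2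
  simp only [mem_nonunits_iff, isUnit_integralClosure_iff] at *
  exact ((padicSpectralValuation p F).map_add_lt ((hle a).lt_of_ne ha) ((hle b).lt_of_ne hb)).ne

theorem padicSpectralValuation_irreducible_lt_one {π : integralClosure ℤ_[p] F}
    (hπ : Irreducible π) : padicSpectralValuation p F (π : F) < 1 :=
  lt_of_le_of_ne ((isIntegral_iff_padicSpectralValuation_le_one _).1 π.2)
    fun h => hπ.not_isUnit ((isUnit_integralClosure_iff π).2 h)

/-- The ring of integers is Dedekind and local, hence a discrete valuation ring with uniformiser
`π`, and its units have valuation `1`. -/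
theorem exists_padicSpectralValuation_eq_zpow [FiniteDimensional ℚ_[p] F]
    {π : integralClosure ℤ_[p] F} (hπ : Irreducible π) {x : F} (hx : x ≠ 0) :
    ∃ n : ℤ, padicSpectralValuation p F x = padicSpectralValuation p F (π : F) ^ n := by
  have := isLocalRing_integralClosure (p := p) (F := F)
  have hded := integralClosure.isDedekindDomain ℤ_[p] ℚ_[p] F
  have := integralClosure.isFractionRing_of_finite_extension (A := ℤ_[p]) ℚ_[p] F
  have hfield : ¬ IsField (integralClosure ℤ_[p] F) := fun h => by
    obtain ⟨y, hy⟩ := h.mul_inv_cancel hπ.ne_zero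
    exact hπ.not_isUnit (IsUnit.of_mul_eq_one y hy)
  have hdvr : IsDiscreteValuationRing (integralClosure ℤ_[p] F) :=
    ((IsDiscreteValuationRing.TFAE (integralClosure ℤ_[p] F) hfield).out 0 2).2 hded
  obtain ⟨n, u, rfl⟩ :=
    IsDiscreteValuationRing.exists_units_eq_smul_zpow_of_irreducible hπ hx
  refine ⟨n, ?_⟩
  rw [Units.smul_def, Algebra.smul_def, map_mul, map_zpow₀]
  have h1 := (isUnit_integralClosure_iff _).1 u.isUnit
  change padicSpectralValuation p F ((u : integralClosure ℤ_[p] F) : F) * _ = _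
  rw [h1, one_mul]
  rfl

end PadicValuation

/-! ### The mod `p` cyclotomic character. -/

section Cyclotomic

variable (p : ℕ) [Fact p.Prime] (K : Type*) [Field K] [Algebra ℚ_[p] K]

/-- The mod `p` cyclotomic character with values in `\overline{𝔽}_p`. -/
def cycBar : GK K →* Fbar p :=
  (algebraMap (ZMod p) (Fbar p) : ZMod p →* Fbar p).comp
    ((Units.coeHom (ZMod p)).comp (cyc p K))

theorem cycBar_apply (g : GK K) :
    cycBar p K g = algebraMap (ZMod p) (Fbar p) (cyc p K g : ZMod p) :=
  rfl

theorem Fbar1_apply (g : GK K) (x : Fbar p) : Fbar1 p K g x = cycBar p K g * x := rfl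

variable {K}

theorem cyc_spec (g : GK K) {t : AlgebraicClosure K} (ht : t ^ p = 1) :
    g t = t ^ (cyc p K g : ZMod p).val := by
  have hp := (Fact.out : p.Prime)
  let u : (AlgebraicClosure K)ˣ := Units.ofPowEqOne t p ht hp.ne_zero
  have hu : u ∈ rootsOfUnity p (AlgebraicClosure K) :=
    (mem_rootsOfUnity _ _).2 (Units.pow_ofPowEqOne ht hp.ne_zero)
  exact modularCyclotomicCharacter.spec (AlgebraicClosure K)
    (card_rootsOfUnity_algebraicClosure p K)
    (MulSemiringAction.toRingAut (GK K) (AlgebraicClosure K) g) hu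

theorem cyc_eq_one_of_fixed {ζ : AlgebraicClosure K} (hζ : IsPrimitiveRoot ζ p) {g : GK K}
    (hg : g ζ = ζ) : cyc p K g = 1 := by
  have hp := (Fact.out : p.Prime)
  have h1 := cyc_spec p g hζ.pow_eq_one
  rw [hg] at h1
  have h2 : (cyc p K g : ZMod p).val = 1 := by
    refine hζ.pow_inj (ZMod.val_lt _) hp.one_lt ?_
    rw [← h1, pow_one]
  ext
  rw [← ZMod.natCast_zmod_val (cyc p K g : ZMod p), h2]
  simp

/-- By Fermat, raising to a power of `p` is the identity on `ZMod p`. This makes the character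
trivial on wild inertia. -/
theorem cyc_eq_one_of_pow {g : GK K} {n : ℕ} (hg : cyc p K (g ^ p ^ n) = 1) : cyc p K g = 1 := by
  ext
  have h1 : (cyc p K g : ZMod p) ^ p ^ n = 1 := by
    rw [← Units.val_pow_eq_pow_val, ← map_pow, hg, Units.val_one]
  rwa [ZMod.pow_card_pow] at h1

variable {p}

theorem IsCyclotomicFree.exists_isTwistFree {V : Type*} [AddCommGroup V] [Module (Fbar p) V]
    [FiniteDimensional (Fbar p) V] {ρ : Representation (Fbar p) (GK K) V}
    (h : IsCyclotomicFree p K ρ) : ∃ s : CompSeries ρ, s.IsTwistFree (cycBar p K) := by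
  obtain ⟨s, hs⟩ := h
  exact ⟨s, fun i hi => hs i (hi.isJHFactor (Fbar1_apply p K) (s.irreducible i))⟩

end Cyclotomic

/-! ### From `K_∞` down to a finite level. -/

section Tower

variable {K : Type*} [Field K]

/-- The stabilizer of an element of the algebraic closure. -/
def stab (x : AlgebraicClosure K) : Subgroup (GK K) := MulAction.stabilizer (GK K) x

theorem mem_stab {x : AlgebraicClosure K} {g : GK K} : g ∈ stab x ↔ g x = x := Iff.rfl

theorem mem_GKinf {ϖ : ℕ → AlgebraicClosure K} {g : GK K} (hg : ∀ n, g (ϖ n) = ϖ n) :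
    g ∈ GKinf ϖ := by
  have h1 : Kinf ϖ ≤ IntermediateField.fixedField (Subgroup.zpowers g) := by
    refine IntermediateField.adjoin_le_iff.2 ?_
    rintro _ ⟨n, rfl⟩
    rw [SetLike.mem_coe, IntermediateField.mem_fixedField_iff]
    intro f hf
    exact (Subgroup.zpowers_le (H := stab (ϖ n))).2 (mem_stab.2 (hg n)) hf
  exact (IntermediateField.le_iff_le _ _).1 h1 (Subgroup.mem_zpowers g)

variable [CharZero K]

/-- An open condition that holds on `G_{K_∞}` holds at a finite level of the tower. -/
theorem exists_stab_subset {p : ℕ} {ϖ : ℕ → AlgebraicClosure K}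
    (hϖ : ∀ n, ϖ (n + 1) ^ p = ϖ n) {U : Set (GK K)} (hU : IsOpen U)
    (h : (GKinf ϖ : Set (GK K)) ⊆ U) : ∃ m, (stab (ϖ m) : Set (GK K)) ⊆ U := by
  by_contra! hne
  have hclosed : ∀ n, IsClosed ((stab (ϖ n) : Set (GK K)) ∩ Uᶜ) := fun n =>
    (Subgroup.isClosed_of_isOpen _ (stabilizer_isOpen_of_isIntegral (K := K) (ϖ n))).inter
      hU.isClosed_compl
  -- A point in all these nested compact sets would fix every `ϖ n`, hence lie in `G_{K_∞}`, yet lie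
  -- outside `U`.
  obtain ⟨g, hg⟩ := IsCompact.nonempty_iInter_of_sequence_nonempty_isCompact_isClosed
    (fun n => (stab (ϖ n) : Set (GK K)) ∩ Uᶜ) (fun n g hg => ⟨by
      have h1 : g (ϖ (n + 1)) = ϖ (n + 1) := hg.1
      change g (ϖ n) = ϖ n
      rw [← hϖ, map_pow, h1], hg.2⟩)
    (fun n => by
      obtain ⟨g, hg, hgU⟩ := Set.not_subset.1 (hne n)
      exact ⟨g, hg, hgU⟩)
    (hclosed 0).isCompact hclosed
  rw [Set.mem_iInter] at hg
  exact (hg 0).2 (h (mem_GKinf fun n => (hg n).1))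

end Tower

/-! ### Wild inertia of a finite layer and the Kummer tower. -/

section Wild

variable {p : ℕ} [Fact p.Prime] {K : Type*} [Field K] [Algebra ℚ_[p] K] [FiniteDimensional ℚ_[p] K]

instance : Algebra.IsAlgebraic ℚ_[p] (AlgebraicClosure K) :=
  Algebra.IsAlgebraic.trans ℚ_[p] K (AlgebraicClosure K)

instance (L : IntermediateField K (AlgebraicClosure K)) : Algebra.IsAlgebraic ℚ_[p] L :=
  Algebra.IsAlgebraic.trans ℚ_[p] K L

theorem padicSpectralValuation_smul (L : IntermediateField K (AlgebraicClosure K))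
    (g : L ≃ₐ[K] L) (x : L) :
    padicSpectralValuation p L (g • x) = padicSpectralValuation p L x :=
  padicSpectralValuation_algEquiv (g.restrictScalars ℚ_[p]) x

variable (p) in
/-- The elements of `G_K` restricting to the wild inertia of `L / K`. -/
def wildSubgroup (L : IntermediateField K (AlgebraicClosure K)) [Normal K L] : Subgroup (GK K) :=
  (wildInertia (padicSpectralValuation p L) (padicSpectralValuation_smul L)).comap
    (AlgEquiv.restrictNormalHom L)

instance (L : IntermediateField K (AlgebraicClosure K)) [Normal K L] :
    (wildSubgroup p L).Normal :=
  wildInertia_normal.comap _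

theorem exists_pow_mem_fixingSubgroup (L : IntermediateField K (AlgebraicClosure K)) [Normal K L]
    [FiniteDimensional K L] {x : GK K} (hx : x ∈ wildSubgroup p L) :
    ∃ n : ℕ, x ^ p ^ n ∈ L.fixingSubgroup := by
  have hP : IsPGroup p (wildInertia (padicSpectralValuation p L) (padicSpectralValuation_smul L)) :=
    isPGroup_wildInertia padicSpectralValuation_prime_lt_one
  obtain ⟨n, hn⟩ := hP ⟨_, hx⟩
  refine ⟨n, ?_⟩
  rw [← IntermediateField.restrictNormalHom_ker, MonoidHom.mem_ker, map_pow]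
  exact congrArg Subtype.val hn

/-- The representation factors through the finite group `Gal(L/K)`, in which wild inertia is a
normal `p`-subgroup. -/
theorem trivialOnFactors_wildSubgroup (L : IntermediateField K (AlgebraicClosure K)) [Normal K L]
    [FiniteDimensional K L] {V : Type*} [AddCommGroup V] [Module (Fbar p) V]
    {ρ : Representation (Fbar p) (GK K) V} (hρ : ∀ g ∈ L.fixingSubgroup, ρ g = 1) :
    TrivialOnFactors (wildSubgroup p L) ρ := by
  have : CharP (Fbar p) p :=
    charP_of_injective_algebraMap (algebraMap (ZMod p) (Fbar p)).injective p
  have hsurj : Function.Surjective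
      (AlgEquiv.restrictNormalHom (F := K) (K₁ := AlgebraicClosure K) L) :=
    AlgEquiv.restrictNormalHom_surjective _
  refine trivialOnFactors_of_pow_eq_one (p := p) ?_ fun x hx => ?_
  · refine (Set.finite_range fun γ : L ≃ₐ[K] L => ρ (Function.surjInv hsurj γ)).subset ?_
    rintro _ ⟨g, rfl⟩
    refine ⟨AlgEquiv.restrictNormalHom L g, ?_⟩
    set h := Function.surjInv hsurj (AlgEquiv.restrictNormalHom L g)
    have h1 : AlgEquiv.restrictNormalHom L h = AlgEquiv.restrictNormalHom L g :=
      Function.surjInv_eq hsurj _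
    have h2 : h⁻¹ * g ∈ L.fixingSubgroup := by
      rw [← IntermediateField.restrictNormalHom_ker, MonoidHom.mem_ker, map_mul, map_inv, h1,
        inv_mul_cancel]
    have h3 : g = h * (h⁻¹ * g) := by group
    change ρ h = ρ g
    rw [h3, map_mul, hρ _ h2, mul_one]
  · obtain ⟨n, hn⟩ := exists_pow_mem_fixingSubgroup L hx
    exact ⟨n, hρ _ hn⟩

variable [Algebra ℤ_[p] K] [IsScalarTower ℤ_[p] ℚ_[p] K]

/-- The wild inertia acts nontrivially on every step of the tower `K(π^{1/p^n})`. -/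
theorem exists_wildSubgroup_apply_ne (L : IntermediateField K (AlgebraicClosure K)) [Normal K L]
    [FiniteDimensional K L] {π : integralClosure ℤ_[p] K} (hπ : Irreducible π) {n : ℕ}
    {a b : AlgebraicClosure K} (ha : a ^ p = b)
    (hb : b ^ p ^ n = algebraMap K (AlgebraicClosure K) π) (haL : a ∈ L) :
    ∃ x ∈ wildSubgroup p L ⊓ stab b, x a ≠ a := by
  have hp := (Fact.out : p.Prime)
  have : CharZero K := charZero_of_injective_algebraMap (algebraMap ℚ_[p] K).injective
  have : IsGalois K L := ⟨⟩
  have hπ0 : (π : K) ≠ 0 := fun h => hπ.ne_zero (Subtype.ext h)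
  let v := padicSpectralValuation p L
  let α : L := ⟨a, haL⟩
  have hαπ : α ^ p ^ (n + 1) = algebraMap K L π := by
    apply Subtype.ext
    change a ^ p ^ (n + 1) = algebraMap K (AlgebraicClosure K) π
    rw [pow_succ', pow_mul, ha, hb]
  have hα0 : α ≠ 0 := by
    rintro h
    rw [h, zero_pow (pow_ne_zero _ hp.ne_zero)] at hαπ
    exact hπ0 ((map_eq_zero (algebraMap K L)).1 hαπ.symm)
  have hvα : v α ^ p ^ (n + 1) = padicSpectralValuation p K (π : K) := by
    rw [← map_pow, hαπ, padicSpectralValuation_algebraMap]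
  have hvα0 : 0 < v α := zero_lt_iff.2 (by simpa using hα0)
  have hvα1 : v α ≠ 1 := fun h => by
    rw [h, one_pow] at hvα
    exact (padicSpectralValuation_irreducible_lt_one hπ).ne hvα.symm
  -- The conjugates of `α ^ p` are `p ^ n`-th roots of `π`, so there are at most `p ^ n` of them.
  have hindex : ¬ p ^ (n + 1) ∣ (MulAction.stabilizer (L ≃ₐ[K] L) (α ^ p)).index := by
    classical
    rw [MulAction.index_stabilizer]
    intro hdvd
    have hsub : MulAction.orbit (L ≃ₐ[K] L) (α ^ p) ⊆
        ((Polynomial.nthRoots (p ^ n) (algebraMap K L π)).toFinset : Set L) := by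
      rintro _ ⟨g, rfl⟩
      simp only [Finset.mem_coe, Multiset.mem_toFinset]
      rw [Polynomial.mem_nthRoots (pow_pos hp.pos _)]
      change (g (α ^ p)) ^ p ^ n = _
      rw [← map_pow, ← pow_mul, ← pow_succ', hαπ, AlgEquiv.commutes]
    have hcard : (MulAction.orbit (L ≃ₐ[K] L) (α ^ p)).ncard ≤ p ^ n := by
      refine (Set.ncard_le_ncard hsub (Finset.finite_toSet _)).trans ?_
      rw [Set.ncard_coe_finset]
      exact (Multiset.toFinset_card_le _).trans (Polynomial.card_nthRoots _ _)
    have hpos : 0 < (MulAction.orbit (L ≃ₐ[K] L) (α ^ p)).ncard :=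
      (Set.ncard_pos ((Finset.finite_toSet _).subset hsub)).2 (MulAction.nonempty_orbit _)
    have := Nat.le_of_dvd hpos hdvd
    exact absurd (this.trans hcard) (not_le.2 (Nat.pow_lt_pow_right hp.one_lt (Nat.lt_succ_self n)))
  -- Nonzero elements of `K` have valuation an integral power of that of `π`, which is `v α ^ p ^ (n
  -- + 1)`.
  have hval : ∀ (x : L) (r : ℕ), (∀ g : L ≃ₐ[K] L, g • x = x) → v x = v α ^ r →
      p ^ (n + 1) ∣ r := by
    intro x r hx hvx
    obtain ⟨y, rfl⟩ := (IsGalois.mem_range_algebraMap_iff_fixed (F := K) x).2 hx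
    have hy : y ≠ 0 := by
      rintro rfl
      rw [map_zero, map_zero] at hvx
      exact (pow_pos hvα0 r).ne hvx
    obtain ⟨k, hk⟩ := exists_padicSpectralValuation_eq_zpow hπ hy
    rw [padicSpectralValuation_algebraMap, hk, ← hvα, ← zpow_natCast, ← zpow_natCast,
      ← zpow_mul] at hvx
    have h1 := zpow_right_injective₀ hvα0 hvα1 hvx
    exact Int.natCast_dvd_natCast.1 ⟨k, by rw [← h1]⟩
  obtain ⟨g, hg, hgα⟩ := exists_wildInertia_smul_ne (hv := padicSpectralValuation_smul L)
    padicSpectralValuation_prime_lt_one hα0 (fun g hg => by rw [← smul_pow']; exact hg) hindex hval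
  obtain ⟨x, rfl⟩ := AlgEquiv.restrictNormalHom_surjective (F := K)
    (K₁ := L) (AlgebraicClosure K) g
  have hx : ∀ y : L, ((AlgEquiv.restrictNormalHom L x • y : L) : AlgebraicClosure K) = x y :=
    fun y => AlgEquiv.restrictNormal_commutes x L y
  refine ⟨x, ⟨hg.1, ?_⟩, fun h => hgα (Subtype.ext ((hx α).trans h))⟩
  change x b = b
  rw [← ha]
  exact (hx (α ^ p)).symm.trans (congrArg Subtype.val (show _ • (α ^ p) = α ^ p from hg.2))

/-- A wild `x` moving `w = ϖ (n + 1)` multiplies it by a primitive `p`-th root of unity `ε`, so its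
powers realise every conjugate of `w` over `ϖ n`. Conjugation by `g` replaces `ε` by `g ε = ε ^
χ(g)`. -/
theorem isKummerChain_stab (L : IntermediateField K (AlgebraicClosure K)) [Normal K L]
    [FiniteDimensional K L] {π : integralClosure ℤ_[p] K} (hπ : Irreducible π)
    {ϖ : ℕ → AlgebraicClosure K} (hϖ_zero : ϖ 0 = algebraMap K (AlgebraicClosure K) π)
    (hϖ_succ : ∀ n, ϖ (n + 1) ^ p = ϖ n) {m : ℕ} (hm : ϖ m ∈ L)
    {ζ : AlgebraicClosure K} (hζ : IsPrimitiveRoot ζ p) (hζL : ζ ∈ L) :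
    IsKummerChain (cycBar p K) (wildSubgroup p L) (fun n => stab (ϖ n)) m := by
  have hp := (Fact.out : p.Prime)
  have hcyc : ∀ x ∈ wildSubgroup p L, cyc p K x = 1 := by
    intro x hx
    obtain ⟨n, hn⟩ := exists_pow_mem_fixingSubgroup L hx
    exact cyc_eq_one_of_pow p (cyc_eq_one_of_fixed p hζ
      ((IntermediateField.mem_fixingSubgroup_iff L _).1 hn ζ hζL))
  have hpow : ∀ n, ϖ n ^ p ^ n = algebraMap K (AlgebraicClosure K) π := by
    intro n
    induction n with
    | zero => simpa using hϖ_zero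
    | succ n ih => rw [pow_succ', pow_mul, hϖ_succ, ih]
  have hϖ0 : ∀ n, ϖ n ≠ 0 := fun n h => by
    have h1 := hpow n
    rw [h, zero_pow (pow_ne_zero _ hp.ne_zero)] at h1
    exact hπ.ne_zero (Subtype.ext ((map_eq_zero (algebraMap K (AlgebraicClosure K))).1 h1.symm))
  have hϖL : ∀ k n, n + k = m → ϖ n ∈ L := by
    intro k
    induction k with
    | zero => rintro n rfl; exact hm
    | succ k ih =>
      intro n hn
      rw [← hϖ_succ]
      exact pow_mem (ih (n + 1) (by omega)) p
  refine ⟨?_, fun x hx => by simp [cycBar_apply, hcyc x hx], fun n hn => ?_⟩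
  · rw [eq_top_iff]
    intro g _
    rw [mem_stab, hϖ_zero, AlgEquiv.commutes]
  set w := ϖ (n + 1) with hw
  have hw0 : w ≠ 0 := hϖ0 _
  obtain ⟨x, hx, hxw⟩ := exists_wildSubgroup_apply_ne L hπ (hϖ_succ n) (hpow n)
    (hϖL (m - (n + 1)) (n + 1) (by omega))
  have hroot : ∀ g ∈ stab (ϖ n), (g w / w) ^ p = 1 := by
    intro g hg
    rw [div_pow, ← map_pow, hϖ_succ, mem_stab.1 hg, div_self (hϖ0 n)]
  set ε := x w / w with hε
  have hxε : x w = ε * w := by rw [hε, div_mul_cancel₀ _ hw0]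
  have hεp : ε ^ p = 1 := hroot x hx.2
  have hε1 : ε ≠ 1 := fun h => hxw (by rw [hxε, h, one_mul])
  have hprim : IsPrimitiveRoot ε p := by
    rw [← orderOf_eq_prime hεp hε1]
    exact IsPrimitiveRoot.orderOf ε
  have hxfix : ∀ t : AlgebraicClosure K, t ^ p = 1 → x t = t := by
    intro t ht
    have : Fact (1 < p) := ⟨hp.one_lt⟩
    rw [cyc_spec p x ht, hcyc x hx.1, Units.val_one, ZMod.val_one, pow_one]
  have hxpow : ∀ j : ℕ, (x ^ j) w = ε ^ j * w := by
    intro j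
    induction j with
    | zero => simp
    | succ j ih =>
      rw [pow_succ', AlgEquiv.mul_apply, ih, map_mul, map_pow, hxfix ε hεp, hxε]
      ring
  have hmem : ∀ (j : ℕ) (g : GK K), g w = ε ^ j * w → (x ^ j)⁻¹ * g ∈ stab w := by
    intro j g hg
    rw [mem_stab, AlgEquiv.mul_apply, hg, ← hxpow, ← AlgEquiv.mul_apply, inv_mul_cancel,
      AlgEquiv.one_apply]
  refine ⟨x, hx, fun g hg => ?_, fun g hg => ?_⟩
  · obtain ⟨j, -, hj⟩ := hprim.eq_pow_of_pow_eq_one (hroot g hg)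
    exact ⟨j, hmem j g (by rw [hj, div_mul_cancel₀ _ hw0])⟩
  · refine ⟨(cyc p K g : ZMod p).val, ?_, hmem _ _ ?_⟩
    · rw [cycBar_apply, ← map_natCast (algebraMap (ZMod p) (Fbar p)), ZMod.natCast_zmod_val]
    · have hg' := (stab (ϖ n)).inv_mem hg
      -- The root of unity `η` by which `g⁻¹` moves `w` is fixed by `x`, so it cancels in `g x g⁻¹
      -- w`, leaving `g ε * w`.
      set η := g⁻¹ w / w with hη
      have h1 : g⁻¹ w = η * w := by rw [hη, div_mul_cancel₀ _ hw0]
      have h2 : g (η * w) = w := by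
        rw [← h1, ← AlgEquiv.mul_apply, mul_inv_cancel, AlgEquiv.one_apply]
      rw [AlgEquiv.mul_apply, AlgEquiv.mul_apply, h1, map_mul x, hxfix η (hroot _ hg'), hxε,
        mul_left_comm, map_mul g, h2, cyc_spec p g hεp]

end Wild

end CycFree

end

/-- Continuity of a finite-dimensional representation `ρ` over the discrete field
`\overline{𝔽}_p` is expressed as local constancy of `g ↦ ρ g`. -/
theorem mainTheorem4 (p : ℕ) [Fact p.Prime]
    (K : Type*) [Field K] [Algebra ℚ_[p] K] [FiniteDimensional ℚ_[p] K]
    [Algebra ℤ_[p] K] [IsScalarTower ℤ_[p] ℚ_[p] K]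
    (π : integralClosure ℤ_[p] K) (hπ : Irreducible π)
    (ϖ : ℕ → AlgebraicClosure K) (hϖ_zero : ϖ 0 = algebraMap K (AlgebraicClosure K) π)
    (hϖ_succ : ∀ n, ϖ (n + 1) ^ p = ϖ n)
    {V W : Type*} [AddCommGroup V] [Module (CycFree.Fbar p) V]
    [FiniteDimensional (CycFree.Fbar p) V]
    [AddCommGroup W] [Module (CycFree.Fbar p) W] [FiniteDimensional (CycFree.Fbar p) W]
    (ρV : Representation (CycFree.Fbar p) (CycFree.GK K) V) (hρV : IsLocallyConstant ρV)
    (ρW : Representation (CycFree.Fbar p) (CycFree.GK K) W) (hρW : IsLocallyConstant ρW)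
    (hV : CycFree.IsCyclotomicFree p K ρV) (hW : CycFree.IsCyclotomicFree p K ρW)
    (f : V →ₗ[CycFree.Fbar p] W)
    (hf : Representation.IsIntertwiningMap (ρV.comp (CycFree.GKinf ϖ).subtype)
      (ρW.comp (CycFree.GKinf ϖ).subtype) f) :
    Representation.IsIntertwiningMap ρV ρW f := by
  have : CharZero K := charZero_of_injective_algebraMap (algebraMap ℚ_[p] K).injective
  have : NeZero (p : AlgebraicClosure K) := ⟨Nat.cast_ne_zero.2 (Fact.out : p.Prime).ne_zero⟩
  obtain ⟨s, hs⟩ := hV.exists_isTwistFree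
  obtain ⟨t, ht⟩ := hW.exists_isTwistFree
  have hVW : IsLocallyConstant fun g => (ρV g, ρW g) := hρV.prodMk hρW
  -- Commuting with `f` depends only on the locally constant pair `(ρV g, ρW g)`, so it is an open
  -- condition.
  obtain ⟨m, hm⟩ := CycFree.exists_stab_subset hϖ_succ
    (hVW {F | f ∘ₗ F.1 = F.2 ∘ₗ f})
    (fun g hg => LinearMap.ext fun v => hf.isIntertwining ⟨g, hg⟩ v)
  obtain ⟨ζ, hζ⟩ := HasEnoughRootsOfUnity.exists_primitiveRoot (AlgebraicClosure K) p
  have hnhds : {g | (ρV g, ρW g) = (1, 1)} ∩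
      ((CycFree.stab (ϖ m) : Set (CycFree.GK K)) ∩ CycFree.stab ζ) ∈
        nhds (1 : CycFree.GK K) := by
    refine IsOpen.mem_nhds (IsOpen.inter (hVW {(1, 1)}) (IsOpen.inter
      (stabilizer_isOpen_of_isIntegral (K := K) (ϖ m))
      (stabilizer_isOpen_of_isIntegral (K := K) ζ))) ?_
    exact ⟨by simp, Subgroup.one_mem _, Subgroup.one_mem _⟩
  -- `L` trivialises both representations; by the Galois correspondence it also contains `ϖ m` and
  -- `ζ`, whose stabilisers contain its fixing subgroup.
  obtain ⟨L, _, _, hL⟩ :=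
    (krullTopology_mem_nhds_one_iff_of_normal K (AlgebraicClosure K) _).1 hnhds
  have hfix : ∀ x : AlgebraicClosure K, (∀ g ∈ L.fixingSubgroup, g x = x) → x ∈ L := by
    intro x hx
    rw [← InfiniteGalois.fixedField_fixingSubgroup L, IntermediateField.mem_fixedField_iff]
    exact hx
  have hchain := CycFree.isKummerChain_stab L hπ hϖ_zero hϖ_succ
    (hfix _ fun g hg => (hL hg).2.1) hζ (hfix _ fun g hg => (hL hg).2.2)
  have hPV := CycFree.trivialOnFactors_wildSubgroup L (ρ := ρV)
    fun g hg => congrArg Prod.fst (hL hg).1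
  have hPW := CycFree.trivialOnFactors_wildSubgroup L (ρ := ρW)
    fun g hg => congrArg Prod.snd (hL hg).1
  exact ⟨fun g v => hchain.equivariant hPV hPW hs ht
    (fun h hh v => LinearMap.congr_fun (hm hh) v) g v⟩
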